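/- **Model.** Time is slotted, and $\lambda$ is the security parameter. Let $n$ be the maximal number of active validators, $\Delta\ge 1$ the network delay, and $m\ge 1$ the number of PoS blocks per epoch. The clients are the uncorrupted validators, which are always online, and arbitrary external clients, each online at an arbitrary set of slots. Corruption is permanent and may happen at any time, and corrupted validators behave arbitrarily. Whatever an honest validator has received or produced reaches every client within $\Delta$ slots (or when the client returns), and online clients forward what they have received to all honest validators within $\Delta$ slots. *Underlying protocol.* Honest validators follow the voting rules of Tendermint, where a prevote carries the round of the quorum of prevotes that justifies it. A block is finalized by precommits of more than $2n/3$ active validators in one round together with the justified prevotes of more than $2n/3$ active validators in that round, and a child block contains the votes that finalized its parent. The active set is fixed during an epoch. At the end of an epoch, the active validators whose withdrawal requests are in that epoch's blocks are replaced from a staking queue, and they never return. The forensic protocol identifies a validator as a violator from two of its votes for different blocks of the same height that are (a) prevotes of the same round, or (b) precommits of the same round, or (c) a precommit in round $r$ and a prevote in a round $r'>r$ that is not justified by a round $\ge r$. *Bitcoin.* A client takes a longest Bitcoin chain in its view and removes a fixed number $d$ of blocks at its end to obtain its confirmed chain $\mathcal C^{\mathsf c}_r$ at slot $r$. Bitcoin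 is secure with parameter $k$ and latency $T$ if: the confirmed chains of any two clients at any slots are prefixes of each other in one direction, and the confirmed chain of a client never rolls back; and if a client sends a transaction to Bitcoin at slot $r$, then it is in the confirmed chain of every client at all slots $\ge r+T$, and $|\mathcal C^{\mathsf c}_{r+T}|\le|\mathcal C^{\mathsf c}_{\max(r-3\Delta,0)}|+k$ for every client $\mathsf c$ that is online at both slots. Both $k$ and $d$ are arbitrary (possibly $d=k$), and $T\ge 2\Delta$. No protocol transaction is on Bitcoin at slot $0$. *Babylon 1.0 with fast finality.* A checkpoint consists of the identifier (height and hash) of a PoS block, an epoch number, and a quorum of votes finalizing the block. A client scans the checkpoints and fraud proofs in $\mathcal C^{\mathsf c}_r$ in order, starting with the genesis chain as checkpointed chain $L$ and ignoring, for later checkpoints and for blocks not yet checkpointed, the votes of validators accused by an earlier fraud proof. A checkpoint is valid if it names the epoch $\tilde e$ of the next block after $L$ and contains a finalizing quorum of the active validators of $\tilde e$. If it is valid, all blocks of its chain are available and finalized in the client's view, its block is of epoch $\tilde e$, and its chain extends $L$, then that chain replaces $L$ (the checkpoint is accepted). If it is valid but some block of its chain is unavailable or not finalized in the client's view at that slot,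 the scan stops (emergency break). Otherwise it is skipped. Without an emergency break the client outputs the chain reached from the tip of $L$ by following finalized blocks as long as there is exactly one finalized child. During an emergency break it keeps its previous output if that extends $L$, and outputs $L$ otherwise. If the break is still caused by the same Bitcoin block $2\Delta$ slots after that block was first confirmed for the client, the client sends to Bitcoin checkpoints of the tip of its output and of the tip of the chain that the rule without break would give at that slot. A client that sees conflicting finalized blocks sends a fraud proof for all violators identified from its view. Honest active validators send a checkpoint at the end of each epoch. *Withdrawal.* A validator has withdrawn in a client's view once, at some slot, the client's output contains its withdrawal transaction and: (1) its withdrawal request, made while active, is in a block $B$ of the client's checkpointed chain; (2) an accepted checkpoint of the last block of $B$'s epoch, or of a descendant of it, lies in a block of $\mathcal C^{\mathsf c}_r$ followed by at least $k$ further blocks of $\mathcal C^{\mathsf c}_r$; (3) no fraud proof in $\mathcal C^{\mathsf c}_r$, and no two checkpoints in $\mathcal C^{\mathsf c}_r$ of conflicting blocks available to the client, incriminate it. Honest validators vote for blocks with withdrawal transactions only under conditions (1)-(3). A validator is slashable in a client's view at a slot if the votes seen by the client identify it as a violator and it has not withdrawn in that view. **Theorem.** Consider random executions of this protocol, indexed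 by $\lambda$, in which at every slot some honest validator is active according to its own PoS chain. Assume that, except with probability negligible in $\lambda$, no two different blocks with the same identifier are available to clients, no vote of a still honest validator is forged, and Bitcoin is secure with parameter $k$ and latency $T$. Then Babylon 1.0 with fast finality satisfies $n/3$-slashable safety with overwhelming probability. That is, except with negligible probability: 1. if there is a safety violation (the outputs of two clients at two slots are not prefixes of each other, or a client's output at some slot is not a prefix of its output at a later slot), then there are a set of at least $n/3$ adversarial validators and a slot from which on all of them are slashable in the view of every online client; and 2. no validator is ever slashable in a client's view while it is honest. -/

import Mathlib

universe u v w x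

namespace Babylon

/-! ## Votes, blocks, chains -/

/-- A PoS block is referred to by its height and its hash. -/
structure BlockId (D : Type w) where
  height : ℕ
  hash : D

/-- The two voting steps of a Tendermint round. A prevote names the round of the quorum of prevotes
that justifies it, if there is one (`none` plays the role of the valid round `-1`). Nil votes never
count towards a quorum and are not represented. -/
inductive VoteKind where
  | prevote (just : Option ℕ)
  | precommit

/-- A signed Tendermint vote. The height is part of the block identifier. -/
structure Vote (V : Type u) (D : Type w) where
  voter : V
  round : ℕ
  block : BlockId D
  kind : VoteKind

/-- Transactions of the PoS chain: joining the staking queue, the withdrawal request, the withdrawal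
transaction that releases the stake, and everything else. -/
inductive Tx (V : Type u) where
  | stake (v : V)
  | request (v : V)
  | withdraw (v : V)
  | other (data : ℕ)

/-- The content of a PoS block: transactions, and (as in Tendermint) the votes that finalized the
parent block. -/
structure Body (V : Type u) (D : Type w) where
  txs : List (Tx V)
  cert : Finset (Vote V D)

/-- A PoS chain, NEWEST block first; `[]` is the chain of the genesis block alone. A block is
identified with the chain ending at it, so that `X` extends `Y` (or equals it) iff `Y <:+ X`. -/
abbrev Chain (V : Type u) (D : Type w) := List (Body V D)

/-- Two blocks (or chains) conflict if neither extends the other. -/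
def Conflict {V : Type u} {D : Type w} (X Y : Chain V D) : Prop :=
  ¬ X <:+ Y ∧ ¬ Y <:+ X

/-- The votes contained in the blocks of a chain. -/
def chainVotes {V : Type u} {D : Type w} (X : Chain V D) : Set (Vote V D) :=
  {a | ∃ b ∈ X, a ∈ b.cert}

/-! ## Parameters -/

/-- Protocol parameters: number `n` of validators, network delay `Δ`, the number `depth` of blocks
that clients remove from the longest Bitcoin chain to obtain the confirmed one, the security
parameter `k` of Bitcoin, which is also the depth at which checkpoints permit withdrawals (in
particular `depth = k` is possible), epoch length `m` in blocks, the initial committee, the hash function (applied to the parent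
hash and the block content), and the external validity of transactions with respect to a prefix. -/
structure Params (V : Type u) (D : Type w) where
  n : ℕ
  Δ : ℕ
  depth : ℕ
  k : ℕ
  m : ℕ
  Δ_pos : 1 ≤ Δ
  m_pos : 1 ≤ m
  genesis : Finset V
  genesis_card : genesis.card = n
  genesisHash : D
  hash : D → Body V D → D
  extValid : Chain V D → Tx V → Prop

/-- The hash of the block at the tip of a chain. -/
def Params.chainHash {V : Type u} {D : Type w} (P : Params V D) : Chain V D → D
  | [] => P.genesisHash
  | b :: X => P.hash (P.chainHash X) b

/-- The identifier of the block at the tip of a chain. -/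
def Params.blockId {V : Type u} {D : Type w} (P : Params V D) (X : Chain V D) : BlockId D :=
  ⟨X.length, P.chainHash X⟩

/-- The epoch (starting at 1) of the block at the tip of a chain `X ≠ []`. -/
def Params.epochOf {V : Type u} {D : Type w} (P : Params V D) (X : Chain V D) : ℕ :=
  (X.length - 1) / P.m + 1

/-- The epoch of a block appended to `X`: the epoch `e` of the tip of `X`, or `e + 1` if that tip
is the last block of its epoch; it is `1` for the genesis chain. -/
def Params.nextEpoch {V : Type u} {D : Type w} (P : Params V D) (X : Chain V D) : ℕ :=
  X.length / P.m + 1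

/-! ## The staking contract -/

/-- State of the staking contract: the active set, the first-in-first-out staking queue, every
validator that has ever entered, and the active validators that asked to leave during the current
epoch. -/
structure StakeState (V : Type u) where
  active : Finset V
  queue : List V
  seen : Finset V
  leaving : Finset V

/-- Effect of a transaction: fresh validators join the queue, active validators may ask to leave. -/
def StakeState.apply {V : Type u} [DecidableEq V] (s : StakeState V) : Tx V → StakeState V
  | .stake v => if v ∈ s.seen then s else
      { s with queue := s.queue ++ [v], seen := insert v s.seen }
  | .request v => if v ∈ s.active then { s with leaving := insert v s.leaving } else s
  | .withdraw _ => s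
  | .other _ => s

/-- End of an epoch: the validators that asked to leave are replaced from the queue, and the active
set has at most `n` members. -/
def StakeState.rotate {V : Type u} [DecidableEq V] (s : StakeState V) (n : ℕ) : StakeState V :=
  let stay := s.active \ s.leaving
  let j := n - stay.card
  { active := stay ∪ (s.queue.take j).toFinset
    queue := s.queue.drop j
    seen := s.seen
    leaving := ∅ }

/-- The state of the staking contract after a chain. -/
def Params.stake {V : Type u} {D : Type w} [DecidableEq V] (P : Params V D) :
    Chain V D → StakeState V
  | [] => ⟨P.genesis, [], P.genesis, ∅⟩
  | b :: X =>
      let s := b.txs.foldl StakeState.apply (P.stake X)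
      if (X.length + 1) % P.m = 0 then s.rotate P.n else s

/-- The active validators that vote on the block appended to `X`. -/
def Params.committee {V : Type u} {D : Type w} [DecidableEq V] (P : Params V D)
    (X : Chain V D) : Set V :=
  {v | v ∈ (P.stake X).active}

/-! ## Tendermint quorums and forensics -/

/-- `Polka n M Q B r`: the votes `M` contain, for block `B` and round `r`, prevotes of more than
`2n/3` validators of `Q`, each of which is itself justified by an earlier such quorum for `B` if it
claims to be. -/
inductive Polka {V : Type u} {D : Type w} (n : ℕ) (M : Set (Vote V D)) (Q : Set V)
    (B : BlockId D) : ℕ → Prop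
  | intro (r : ℕ) (S : Finset V) (just : V → Option ℕ)
      (sub : ∀ v ∈ S, v ∈ Q) (quorum : 2 * n < 3 * S.card)
      (votes : ∀ v ∈ S, (⟨v, r, B, .prevote (just v)⟩ : Vote V D) ∈ M)
      (lt : ∀ v ∈ S, ∀ j, just v = some j → j < r)
      (justified : ∀ v ∈ S, ∀ j, just v = some j → Polka n M Q B j) : Polka n M Q B r

/-- The votes `M` finalize block `B` with validators from `Q`: in some round there are precommits
of more than `2n/3` validators of `Q`, backed by the quorum of prevotes of that round. -/
def Certifies {V : Type u} {D : Type w} (n : ℕ) (M : Set (Vote V D)) (Q : Set V)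
    (B : BlockId D) : Prop :=
  ∃ (r : ℕ) (S : Finset V), (∀ v ∈ S, v ∈ Q) ∧ 2 * n < 3 * S.card ∧
    (∀ v ∈ S, (⟨v, r, B, .precommit⟩ : Vote V D) ∈ M) ∧ Polka n M Q B r

/-- Every block of the chain is externally valid and carries votes that finalize its parent. -/
def Params.ValidChain {V : Type u} {D : Type w} [DecidableEq V] (P : Params V D) :
    Chain V D → Prop
  | [] => True
  | [b] => ∀ t ∈ b.txs, P.extValid [] t
  | b :: c :: X => (∀ t ∈ b.txs, P.extValid (c :: X) t) ∧
      Certifies P.n (b.cert : Set (Vote V D)) (P.committee X) (P.blockId (c :: X)) ∧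
      P.ValidChain (c :: X)

/-- The validators that vote on the block at the tip of `X`. -/
def Params.signers {V : Type u} {D : Type w} [DecidableEq V] (P : Params V D)
    (X : Chain V D) : Set V :=
  P.committee X.tail

/-- The forensic protocol: the votes `M` irrefutably identify `v` as a protocol violator if they
contain two votes of `v` for different blocks of the same height that are
two prevotes of the same round, or two precommits of the same round, or
a precommit and a prevote of a later round that is not justified by a quorum of prevotes from the
round of the precommit or later. -/
def Violates {V : Type u} {D : Type w} (M : Set (Vote V D)) (v : V) : Prop :=
  ∃ a ∈ M, ∃ b ∈ M, a.voter = v ∧ b.voter = v ∧ a.block.height = b.block.height ∧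
    a.block ≠ b.block ∧
    ((a.round = b.round ∧ ∃ i j, a.kind = .prevote i ∧ b.kind = .prevote j) ∨
     (a.round = b.round ∧ a.kind = .precommit ∧ b.kind = .precommit) ∨
     (a.round < b.round ∧ a.kind = .precommit ∧
       ∃ j, b.kind = .prevote j ∧ ∀ i, j = some i → i < a.round))

/-! ## Bitcoin -/

/-- A checkpoint: block identifier, epoch number, and votes finalizing the block. -/
structure Checkpoint (V : Type u) (D : Type w) where
  block : BlockId D
  epoch : ℕ
  sigs : Finset (Vote V D)

/-- The Bitcoin transactions relevant for the protocol: checkpoints and fraud proofs. -/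
inductive BtcTx (V : Type u) (D : Type w) where
  | checkpoint (cp : Checkpoint V D)
  | fraud (evidence : Finset (Vote V D))

/-- The votes contained in a Bitcoin transaction. -/
def BtcTx.votes {V : Type u} {D : Type w} : BtcTx V D → Finset (Vote V D)
  | .checkpoint cp => cp.sigs
  | .fraud S => S

/-- A Bitcoin block; everything that is not a protocol transaction is subsumed in `rest`. -/
structure BtcBlock (V : Type u) (D : Type w) where
  txs : List (BtcTx V D)
  rest : ℕ

/-- A Bitcoin chain, OLDEST block first, so that the prefix order is `<+:`. -/
abbrev BtcChain (V : Type u) (D : Type w) := List (BtcBlock V D)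

/-- A transaction occurs in a Bitcoin chain. -/
def BtcChain.Has {V : Type u} {D : Type w} (C : BtcChain V D) (t : BtcTx V D) : Prop :=
  ∃ b ∈ C, t ∈ b.txs

/-- The protocol transactions of a Bitcoin chain in their order, each with the position of its
block. -/
def BtcChain.items {V : Type u} {D : Type w} (C : BtcChain V D) : List (ℕ × BtcTx V D) :=
  C.zipIdx.flatMap fun p => p.1.txs.map fun t => (p.2, t)

/-! ## Views and the fork-choice rule -/

/-- What a node has received: PoS blocks, votes, and chains of Bitcoin blocks. -/
structure View (V : Type u) (D : Type w) where
  blocks : Finset (Chain V D)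
  votes : Finset (Vote V D)
  btc : Finset (BtcChain V D)

/-- Inclusion of views. -/
def View.Sub {V : Type u} {D : Type w} (A B : View V D) : Prop :=
  A.blocks ⊆ B.blocks ∧ A.votes ⊆ B.votes ∧ A.btc ⊆ B.btc

/-- All votes a node has seen, in whichever message. -/
def View.known {V : Type u} {D : Type w} (A : View V D) : Set (Vote V D) :=
  {a | a ∈ A.votes ∨ (∃ b X, b :: X ∈ A.blocks ∧ a ∈ b.cert) ∨
    ∃ C ∈ A.btc, ∃ t, C.Has t ∧ a ∈ t.votes}

/-- Every block of the chain has been received. -/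
def View.Available {V : Type u} {D : Type w} (A : View V D) (X : Chain V D) : Prop :=
  ∀ Y, Y <:+ X → Y ≠ [] → Y ∈ A.blocks

/-- The block at the tip of `X` is finalized by Tendermint in a view. -/
def Params.Finalized {V : Type u} {D : Type w} [DecidableEq V] (P : Params V D)
    (A : View V D) (X : Chain V D) : Prop :=
  X ≠ [] ∧ A.Available X ∧ P.ValidChain X ∧ Certifies P.n A.known (P.signers X) (P.blockId X)

/-- State of the scan through the checkpoints: the checkpointed chain, the validators accused by
the fraud proofs met so far, the accepted checkpoints (position of the Bitcoin block and chain), and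
the position of the Bitcoin block whose checkpoint pulled the emergency break, if any. -/
structure ScanState (V : Type u) (D : Type w) where
  chain : Chain V D
  accused : Set V
  accepted : List (ℕ × Chain V D)
  stalled : Option ℕ

/-- Validity of a checkpoint after the checkpointed chain `L`, where the signatures of the
validators in `A` are not considered. -/
def Params.ValidCheckpoint {V : Type u} {D : Type w} [DecidableEq V] (P : Params V D)
    (L : Chain V D) (A : Set V) (cp : Checkpoint V D) : Prop :=
  cp.epoch = P.nextEpoch L ∧
    Certifies P.n (cp.sigs : Set (Vote V D)) (P.committee L \ A) cp.block

/-- Every block of `X` is available and finalized in the view; for the blocks that are not yet in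
the checkpointed chain `L`, the signatures of the validators in `A` are not considered. -/
def Params.AvailableFinal {V : Type u} {D : Type w} [DecidableEq V] (P : Params V D)
    (W : View V D) (L : Chain V D) (A : Set V) (X : Chain V D) : Prop :=
  W.Available X ∧ P.ValidChain X ∧
    ∀ Y, Y <:+ X → Y ≠ [] → ¬ Y <:+ L →
      Certifies P.n W.known (P.signers Y \ A) (P.blockId Y)

/-- `X` is an opening of the checkpoint that allows it to become the checkpointed chain. -/
def Params.Acceptable {V : Type u} {D : Type w} [DecidableEq V] (P : Params V D)
    (W : View V D) (L : Chain V D) (A : Set V) (cp : Checkpoint V D) (X : Chain V D) : Prop :=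
  P.blockId X = cp.block ∧ P.AvailableFinal W L A X ∧ X ≠ [] ∧
    P.epochOf X = P.nextEpoch L ∧ L <:+ X

open Classical in
/-- One step of the scan. A valid checkpoint is accepted, or pulls the emergency break if its chain
is unavailable or not finalized in the view; it is skipped otherwise. -/
noncomputable def Params.scanStep {V : Type u} {D : Type w} [DecidableEq V] (P : Params V D)
    (W : View V D) (s : ScanState V D) (it : ℕ × BtcTx V D) : ScanState V D :=
  if s.stalled.isSome then s else
  match it.2 with
  | .fraud S => { s with accused := s.accused ∪ {v | Violates (S : Set (Vote V D)) v} }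
  | .checkpoint cp =>
      if P.ValidCheckpoint s.chain s.accused cp then
        if h : ∃ X, P.Acceptable W s.chain s.accused cp X then
          { s with chain := h.choose, accepted := s.accepted ++ [(it.1, h.choose)] }
        else if ∃ X, P.blockId X = cp.block ∧ P.AvailableFinal W s.chain s.accused X then s
        else { s with stalled := some it.1 }
      else s

/-- The scan of a Bitcoin chain from its beginning. -/
noncomputable def Params.scan {V : Type u} {D : Type w} [DecidableEq V] (P : Params V D)
    (W : View V D) (C : BtcChain V D) : ScanState V D :=
  C.items.foldl (P.scanStep W) ⟨[], ∅, [], none⟩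

/-- The fast finality walk in the tree of finalized blocks: go on as long as there is exactly one
finalized child, and stop at a leaf or at a fork. -/
inductive Walk {V : Type u} {D : Type w} (fin : Chain V D → Prop) :
    Chain V D → Chain V D → Prop
  | done (X : Chain V D) (h : ¬ ∃! b, fin (b :: X)) : Walk fin X X
  | step (X Y : Chain V D) (b : Body V D) (h : fin (b :: X))
      (uniq : ∀ b', fin (b' :: X) → b' = b) (next : Walk fin (b :: X) Y) : Walk fin X Y

/-! ## Executions -/

/-- Clients are the (honest) validators and the external clients. -/
abbrev Client (V : Type u) (X : Type v) := V ⊕ X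

/-- A record of a protocol execution, by slots. -/
structure Execution (V : Type u) (X : Type v) (D : Type w) where
  /-- validators that are not corrupted at a slot -/
  honest : ℕ → Set V
  /-- slots at which an external client is online -/
  online : X → Set ℕ
  /-- everything a client has received by a slot -/
  view : Client V X → ℕ → View V D
  /-- the longest Bitcoin chain that the client adopts -/
  longest : Client V X → ℕ → BtcChain V D
  /-- the PoS chain output by the client -/
  out : Client V X → ℕ → Chain V D
  /-- the transactions that the client sends to Bitcoin -/
  sent : Client V X → ℕ → Set (BtcTx V D)
  /-- the votes that an honest validator signs -/
  signed : V → ℕ → Set (Vote V D)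

namespace Execution

/-- The client runs the protocol at a slot: validators while they are honest, external clients while
they are online. -/
def Live {V : Type u} {X : Type v} {D : Type w} (E : Execution V X D) :
    Client V X → ℕ → Prop
  | .inl v, r => v ∈ E.honest r
  | .inr x, r => r ∈ E.online x

/-- The confirmed Bitcoin chain: the longest chain without its last `depth` blocks. -/
def btc {V : Type u} {X : Type v} {D : Type w} (E : Execution V X D) (P : Params V D)
    (c : Client V X) (r : ℕ) : BtcChain V D :=
  (E.longest c r).take ((E.longest c r).length - P.depth)

/-- The result of the scan; its chain is the checkpointed chain of the client. -/
noncomputable def scan {V : Type u} {X : Type v} {D : Type w} [DecidableEq V]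
    (E : Execution V X D) (P : Params V D) (c : Client V X) (r : ℕ) : ScanState V D :=
  P.scan (E.view c r) (E.btc P c r)

/-- The chain output by the client before slot `r`. -/
def prevOut {V : Type u} {X : Type v} {D : Type w} (E : Execution V X D) (c : Client V X) :
    ℕ → Chain V D
  | 0 => []
  | r + 1 => E.out c r

/-- In the confirmed Bitcoin chain of the client there are checkpoints of conflicting blocks that
implicate `v` in a protocol violation. -/
def Implicated {V : Type u} {X : Type v} {D : Type w} [DecidableEq V]
    (E : Execution V X D) (P : Params V D) (c : Client V X) (r : ℕ) (v : V) : Prop :=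
  ∃ (cp₁ cp₂ : Checkpoint V D) (Y₁ Y₂ : Chain V D),
    (E.btc P c r).Has (.checkpoint cp₁) ∧ (E.btc P c r).Has (.checkpoint cp₂) ∧
    P.blockId Y₁ = cp₁.block ∧ P.blockId Y₂ = cp₂.block ∧
    (E.view c r).Available Y₁ ∧ (E.view c r).Available Y₂ ∧
    P.ValidChain Y₁ ∧ P.ValidChain Y₂ ∧
    Certifies P.n (cp₁.sigs : Set (Vote V D)) (P.signers Y₁) cp₁.block ∧
    Certifies P.n (cp₂.sigs : Set (Vote V D)) (P.signers Y₂) cp₂.block ∧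
    Conflict Y₁ Y₂ ∧
    Violates (chainVotes Y₁ ∪ cp₁.sigs ∪ (chainVotes Y₂ ∪ cp₂.sigs)) v

/-- Permission of `v` to withdraw in the view of the client at slot `r`: the request of the active
validator `v` is in a block of the checkpointed chain; an accepted checkpoint of the last block of
the epoch of that block, or of a descendant, is at least `k` deep in the confirmed Bitcoin chain;
neither a fraud proof nor checkpoints of conflicting blocks there incriminate `v`. -/
def Permitted {V : Type u} {X : Type v} {D : Type w} [DecidableEq V]
    (E : Execution V X D) (P : Params V D) (c : Client V X) (r : ℕ) (v : V) : Prop :=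
  (∃ (b : Body V D) (Y : Chain V D), b :: Y <:+ (E.scan P c r).chain ∧
    Tx.request v ∈ b.txs ∧ v ∈ P.committee Y ∧
    ∃ (i : ℕ) (Z : Chain V D), (i, Z) ∈ (E.scan P c r).accepted ∧ b :: Y <:+ Z ∧
      P.m * P.epochOf (b :: Y) ≤ Z.length ∧ i + P.k < (E.btc P c r).length) ∧
  (¬ ∃ S : Finset (Vote V D), (E.btc P c r).Has (.fraud S) ∧
    Violates (S : Set (Vote V D)) v) ∧
  ¬ E.Implicated P c r v

/-- `v` has withdrawn its stake in the view of the client by slot `r`: at some slot so far the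
client has output a chain with the withdrawal transaction while the permission held. -/
def Withdrawn {V : Type u} {X : Type v} {D : Type w} [DecidableEq V]
    (E : Execution V X D) (P : Params V D) (c : Client V X) (r : ℕ) (v : V) : Prop :=
  ∃ s ≤ r, E.Live c s ∧ E.Permitted P c s v ∧ ∃ b ∈ E.out c s, Tx.withdraw v ∈ b.txs

/-- `v` is slashable in the view of the client at slot `r`. -/
def Slashable {V : Type u} {X : Type v} {D : Type w} [DecidableEq V]
    (E : Execution V X D) (P : Params V D) (c : Client V X) (r : ℕ) (v : V) : Prop :=
  Violates (E.view c r).known v ∧ ¬ E.Withdrawn P c r v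

/-- The client sends a checkpoint of the block at the tip of `Y` at slot `s`. -/
def SendsCheckpoint {V : Type u} {X : Type v} {D : Type w} [DecidableEq V]
    (E : Execution V X D) (P : Params V D) (c : Client V X) (s : ℕ) (Y : Chain V D) : Prop :=
  ∃ S : Finset (Vote V D), (S : Set (Vote V D)) ⊆ (E.view c s).known ∧
    Certifies P.n (S : Set (Vote V D)) (P.signers Y) (P.blockId Y) ∧
    BtcTx.checkpoint ⟨P.blockId Y, P.epochOf Y, S⟩ ∈ E.sent c s

/-- Synchronous network with delay `Δ`. Everything received or produced by an honest validator
reaches all clients within `Δ` slots (or upon their return), and clients forward what they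
see to the validators. Clients know the Bitcoin chains in their view and take a longest one; no
protocol transaction is on Bitcoin before the start. -/
structure Network {V : Type u} {X : Type v} {D : Type w}
    (E : Execution V X D) (P : Params V D) : Prop where
  honest_antitone : ∀ r s, r ≤ s → E.honest s ⊆ E.honest r
  view_mono : ∀ c r s, r ≤ s → (E.view c r).Sub (E.view c s)
  to_validators : ∀ c r v s, E.Live c r → v ∈ E.honest s → r + P.Δ ≤ s →
    (E.view c r).Sub (E.view (.inl v) s)
  from_validators : ∀ v r c s, v ∈ E.honest r → E.Live c s → r + P.Δ ≤ s →
    (E.view (.inl v) r).Sub (E.view c s)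
  own_votes : ∀ v r, v ∈ E.honest r → ∀ a ∈ E.signed v r, a ∈ (E.view (.inl v) r).votes
  longest_mem : ∀ c r, E.Live c r → E.longest c r ∈ (E.view c r).btc
  longest_max : ∀ c r, E.Live c r → ∀ C ∈ (E.view c r).btc, C.length ≤ (E.longest c r).length
  btc_start : ∀ c, ∀ C ∈ (E.view c 0).btc, ∀ b ∈ C, b.txs = []

/-- The behaviour of clients: the fast finality fork-choice rule with the emergency break, during
which nothing is rolled back and nothing new is output beyond the checkpointed chain; fraud proofs;
and the checkpoint that is sent `2Δ` slots after a still unresolved checkpoint was first observed.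
-/
structure ClientRules {V : Type u} {X : Type v} {D : Type w} [DecidableEq V]
    (E : Execution V X D) (P : Params V D) : Prop where
  offline : ∀ c r, ¬ E.Live c r → E.out c r = E.prevOut c r
  normal : ∀ c r, E.Live c r → (E.scan P c r).stalled = none →
    Walk (P.Finalized (E.view c r)) (E.scan P c r).chain (E.out c r)
  frozen : ∀ c r, E.Live c r → (E.scan P c r).stalled ≠ none →
    (E.scan P c r).chain <:+ E.prevOut c r → E.out c r = E.prevOut c r
  reset : ∀ c r, E.Live c r → (E.scan P c r).stalled ≠ none →
    ¬ (E.scan P c r).chain <:+ E.prevOut c r → E.out c r = (E.scan P c r).chain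
  fraud : ∀ c r, E.Live c r → ∀ Y Z, P.Finalized (E.view c r) Y → P.Finalized (E.view c r) Z →
    Conflict Y Z → ∃ s ≤ r, E.Live c s ∧ ∃ S : Finset (Vote V D),
      (S : Set (Vote V D)) ⊆ (E.view c s).known ∧ BtcTx.fraud S ∈ E.sent c s ∧
      ∀ v, Violates (E.view c r).known v → Violates (S : Set (Vote V D)) v
  emergency : ∀ c t i, E.Live c t → E.Live c (t + 2 * P.Δ) →
    i < (E.btc P c t).length → (∀ s < t, E.Live c s → (E.btc P c s).length ≤ i) →
    (E.scan P c (t + 2 * P.Δ)).stalled = some i →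
    ∀ Y, Y ≠ [] →
      (Y = E.out c (t + 2 * P.Δ) ∨
        Walk (P.Finalized (E.view c (t + 2 * P.Δ))) (E.scan P c (t + 2 * P.Δ)).chain Y) →
      E.SendsCheckpoint P c (t + 2 * P.Δ) Y

/-- The behaviour of honest validators: the Tendermint voting rules, votes for blocks with a
withdrawal only under the permission to withdraw, and the checkpoints at the ends of epochs. -/
structure ValidatorRules {V : Type u} {X : Type v} {D : Type w} [DecidableEq V]
    (E : Execution V X D) (P : Params V D) : Prop where
  own_name : ∀ v r, v ∈ E.honest r → ∀ a ∈ E.signed v r, a.voter = v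
  proposal : ∀ v r, v ∈ E.honest r → ∀ a ∈ E.signed v r, ∃ (b : Body V D) (Y : Chain V D),
    a.block = P.blockId (b :: Y) ∧ (E.view (.inl v) r).Available (b :: Y) ∧
    P.ValidChain (b :: Y) ∧ (Y = [] ∨ P.Finalized (E.view (.inl v) r) Y) ∧ v ∈ P.committee Y ∧
    (∀ u, Tx.withdraw u ∈ b.txs → E.Permitted P (.inl v) r u) ∧
    (∀ i, a.kind = .prevote (some i) → i < a.round ∧
      Polka P.n (E.view (.inl v) r).known (P.committee Y) a.block i) ∧
    (a.kind = .precommit →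
      Polka P.n (E.view (.inl v) r).known (P.committee Y) a.block a.round)
  one_prevote : ∀ v r s, v ∈ E.honest r → v ∈ E.honest s → ∀ a ∈ E.signed v r,
    ∀ b ∈ E.signed v s, a.block.height = b.block.height → a.round = b.round →
    ∀ i j, a.kind = .prevote i → b.kind = .prevote j → a.block = b.block
  one_precommit : ∀ v r s, v ∈ E.honest r → v ∈ E.honest s → ∀ a ∈ E.signed v r,
    ∀ b ∈ E.signed v s, a.block.height = b.block.height → a.round = b.round →
    a.kind = .precommit → b.kind = .precommit → a.block = b.block
  rounds : ∀ v r s, v ∈ E.honest r → v ∈ E.honest s → r < s → ∀ a ∈ E.signed v r,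
    ∀ b ∈ E.signed v s, a.block.height = b.block.height → a.round ≤ b.round
  locking : ∀ v r s, v ∈ E.honest r → v ∈ E.honest s → r ≤ s → ∀ a ∈ E.signed v r,
    ∀ b ∈ E.signed v s, a.block.height = b.block.height → a.round < b.round →
    a.kind = .precommit → ∀ j, b.kind = .prevote j →
    a.block = b.block ∨ ∃ i, j = some i ∧ a.round ≤ i
  epoch_end : ∀ v r, v ∈ E.honest r → ∀ Y, Y <:+ E.out (.inl v) r → Y ≠ [] →
    P.m ∣ Y.length → v ∈ P.signers Y →
    ∃ s ≤ r, E.SendsCheckpoint P (.inl v) s Y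

/-- An execution of Babylon 1.0 with fast finality. Corrupted validators are not restricted. -/
structure IsBabylon {V : Type u} {X : Type v} {D : Type w} [DecidableEq V]
    (E : Execution V X D) (P : Params V D) : Prop where
  network : E.Network P
  clients : E.ClientRules P
  validators : E.ValidatorRules P

/-- At every slot some honest validator is active (according to its own PoS chain). -/
def HonestActive {V : Type u} {X : Type v} {D : Type w} [DecidableEq V]
    (E : Execution V X D) (P : Params V D) : Prop :=
  ∀ r, ∃ v ∈ E.honest r, v ∈ P.committee (E.out (.inl v) r)

/-! ## Events -/

/-- No two different chains with the same identifier have been opened to clients. -/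
def NoCollision {V : Type u} {X : Type v} {D : Type w}
    (E : Execution V X D) (P : Params V D) : Prop :=
  ∀ c r c' r', E.Live c r → E.Live c' r' → ∀ Y Z, (E.view c r).Available Y →
    (E.view c' r').Available Z → P.blockId Y = P.blockId Z → Y = Z

/-- Votes of a validator that is still honest have been signed by it. -/
def NoForgery {V : Type u} {X : Type v} {D : Type w} (E : Execution V X D) : Prop :=
  ∀ c r, E.Live c r → ∀ a ∈ (E.view c r).known, a.voter ∈ E.honest r →
    ∃ s ≤ r, a ∈ E.signed a.voter s

/-- Bitcoin is secure with parameter `k` and latency `T`: safety, liveness, and the bound `k` on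
the growth of the confirmed chain until a transaction sent to Bitcoin is confirmed. -/
structure BitcoinSecure {V : Type u} {X : Type v} {D : Type w}
    (E : Execution V X D) (P : Params V D) (T : ℕ) : Prop where
  consistent : ∀ c r c' r', E.Live c r → E.Live c' r' →
    E.btc P c r <+: E.btc P c' r' ∨ E.btc P c' r' <+: E.btc P c r
  monotone : ∀ c r r', r ≤ r' → E.Live c r → E.Live c r' → E.btc P c r <+: E.btc P c r'
  live : ∀ c s t, E.Live c s → t ∈ E.sent c s →
    ∀ c' r, E.Live c' r → s + T ≤ r → (E.btc P c' r).Has t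
  growth : ∀ c s t, E.Live c s → t ∈ E.sent c s →
    ∀ c', E.Live c' (s - 3 * P.Δ) → E.Live c' (s + T) →
      (E.btc P c' (s + T)).length ≤ (E.btc P c' (s - 3 * P.Δ)).length + P.k

/-- Safety of the PoS chains. -/
def Safe {V : Type u} {X : Type v} {D : Type w} (E : Execution V X D) : Prop :=
  (∀ c r c' r', E.Live c r → E.Live c' r' →
    E.out c r <:+ E.out c' r' ∨ E.out c' r' <:+ E.out c r) ∧
  ∀ c r r', r ≤ r' → E.Live c r → E.Live c r' → E.out c r <:+ E.out c r'

/-- Slashable safety with resilience `f`: after a safety violation, at least `f` adversarial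
validators become (and stay) slashable in the view of all clients; and no honest validator ever
becomes slashable in the view of a client. -/
def SlashablySafe {V : Type u} {X : Type v} {D : Type w} [DecidableEq V]
    (E : Execution V X D) (P : Params V D) (f : ℝ) : Prop :=
  (¬ E.Safe → ∃ (S : Finset V) (R : ℕ), f ≤ S.card ∧ ∀ v ∈ S, v ∉ E.honest R ∧
    ∀ c r, R ≤ r → E.Live c r → E.Slashable P c r v) ∧
  ∀ v c r, v ∈ E.honest r → E.Live c r → ¬ E.Slashable P c r v

end Execution

/-- A property of random outcomes, indexed by the security parameter, holds except with a
probability that is negligible in the security parameter. -/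
def Overwhelming {Ω : ℕ → Type x} [∀ s, MeasurableSpace (Ω s)]
    (μ : ∀ s, MeasureTheory.Measure (Ω s)) (p : ∀ s, Ω s → Prop) : Prop :=
  Asymptotics.SuperpolynomialDecay Filter.atTop (fun s : ℕ => (s : ℝ))
    (fun s : ℕ => (μ s {ω | ¬ p s ω}).toReal)

end Babylon

/-! The probabilistic part is a union bound: outside the exceptional events an execution is
`Regular`, and for such an execution slashable safety holds deterministically. Honest validators are
never slashable, because unforged votes that follow the voting rules match none of the violation
patterns (`not_violates`).

Conflicting outputs split at a last common chain `Y` with two finalized children, so quorum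
intersection (`violators_of_certifies`) yields more than `n/3` violators in the committee of `Y`.
Their only escape is withdrawal. A validator that asked to leave has left the committee by the end
of the epoch of its request, so a member of the committee of `Y` may withdraw only when a checkpoint
by which the scan leaves `Y` is `k` deep (`exists_crosses_of_permitted`). This crossing, its
position `p` and its chain `Z` are the same for all clients (`Crosses.unique`). It therefore
suffices that evidence is sent to Bitcoin at a slot `s` such that the confirmed chain at `s - 3Δ`
does not yet contain position `p`: by the growth bound the evidence is then confirmed before the
crossing is `k` deep.

If no client ever crosses, no withdrawal is permitted. Otherwise one of the outputs disagrees with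
`Z`, at `Y` or at an earlier fork, and it was produced by the fast finality rule of an unstalled
client, which had not confirmed `p` (`exists_normal`, `length_le_of_normal`). Take a validator that
stays honest long enough and the slot `t` at which it first confirms `p`. By `t + 2Δ` it has
received that output. If it has accepted `Z`, it sees the fork and a fraud proof is sent. If not, it
is stalled at or before `p`; going back to a stall whose position was first confirmed exactly `2Δ`
slots earlier (`exists_emergency`), it checkpoints the end of its walk. Either this chain contains
the conflicting child, and together with the checkpoint of `Z` it implicates the violators, or the
walk was stopped by another visible fork, which gives a fraud proof.

A rollback by a single client can only be a shortening of its output. This needs a fork seen by an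
unstalled client, and the fraud proof is again in time (`out_mono_or_thirdSlashable`). -/

namespace Babylon

/-! ### Chains as lists: suffixes, forks and comparable prefixes. -/

section Suffix

variable {α : Type*}

theorem cons_suffix_of_ne {X Y : List α} (h : Y <:+ X) (hne : Y ≠ X) : ∃ b, b :: Y <:+ X := by
  obtain ⟨t, rfl⟩ := h
  rcases List.eq_nil_or_concat t with rfl | ⟨t, b, rfl⟩
  · simp at hne
  · exact ⟨b, t, by simp⟩

theorem suffix_of_cons_suffix {X Y : List α} {b : α} (h : b :: Y <:+ X) : Y <:+ X :=
  (List.suffix_cons b Y).trans h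

theorem cons_suffix_inj {X Y : List α} {b c : α} (h : b :: Y <:+ X) (h' : c :: Y <:+ X) :
    b = c := by
  have := List.suffix_of_suffix_length_le h h' (by simp)
  have := this.eq_of_length (by simp)
  simpa using this

theorem cons_not_suffix_self {Y : List α} {b : α} : ¬ b :: Y <:+ Y := fun h => by
  simpa using h.length_le

/-- Localizes a conflict at the last common block, whose successor committee signs both children;
all accountability arguments take place there. -/
theorem exists_fork {X Z : List α} (h : ¬ X <:+ Z) (h' : ¬ Z <:+ X) :
    ∃ Y b c, b ≠ c ∧ b :: Y <:+ X ∧ c :: Y <:+ Z := by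
  induction X with
  | nil => exact absurd (List.nil_suffix) h
  | cons a X ih =>
    by_cases hX : X <:+ Z
    · have hne : X ≠ Z := fun e => h' (e ▸ List.suffix_cons a X)
      obtain ⟨c, hc⟩ := cons_suffix_of_ne hX hne
      exact ⟨X, a, c, fun e => h (e ▸ hc), List.suffix_rfl, hc⟩
    · obtain ⟨Y, b, c, hbc, hb, hc⟩ := ih hX fun e => h' (e.trans (List.suffix_cons a X))
      exact ⟨Y, b, c, hbc, hb.trans (List.suffix_cons a X), hc⟩

theorem suffix_or_cons_suffix {L X Y : List α} {b : α} (hL : L <:+ X) (hY : b :: Y <:+ X) :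
    L <:+ Y ∨ b :: Y <:+ L := by
  rcases List.suffix_or_suffix_of_suffix hL hY with h | h
  · rcases List.suffix_cons_iff.1 h with rfl | h
    · exact Or.inr List.suffix_rfl
    · exact Or.inl h
  · exact Or.inr h

/-- Chains through different children of `Y` are incomparable. -/
theorem fork_not_suffix {X Y Z : List α} {b c : α} (hbc : b ≠ c) (hb : b :: Y <:+ X)
    (hc : c :: Y <:+ Z) : ¬ X <:+ Z :=
  fun h => hbc (cons_suffix_inj (hb.trans h) hc)

theorem prefix_of_comparable {C C' : List α} (h : C <+: C' ∨ C' <+: C)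
    (hl : C.length ≤ C'.length) : C <+: C' := by
  rcases h with h | h
  · exact h
  · rw [h.eq_of_length_le hl]

end Suffix

/-! ### The staking contract: size of the active set, permanence of departures, epochs. -/

section Stake

variable {V : Type u} {D : Type w} [DecidableEq V] (P : Params V D)

theorem StakeState.apply_active (s : StakeState V) (t : Tx V) : (s.apply t).active = s.active := by
  cases t <;> simp only [StakeState.apply] <;> split_ifs <;> rfl

theorem StakeState.foldl_apply_active (l : List (Tx V)) (s : StakeState V) :
    (l.foldl StakeState.apply s).active = s.active := by
  induction l generalizing s with
  | nil => rfl
  | cons t l ih => rw [List.foldl_cons, ih, StakeState.apply_active]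

theorem StakeState.card_rotate_le (s : StakeState V) (n : ℕ) (h : s.active.card ≤ n) :
    (s.rotate n).active.card ≤ n := by
  have h1 : (s.active \ s.leaving).card ≤ n := (Finset.card_le_card Finset.sdiff_subset).trans h
  have h2 : ((s.queue.take (n - (s.active \ s.leaving).card)).toFinset).card
      ≤ n - (s.active \ s.leaving).card :=
    (List.toFinset_card_le _).trans (by simp)
  have h3 := Finset.card_union_le (s.active \ s.leaving)
    (s.queue.take (n - (s.active \ s.leaving).card)).toFinset
  simp only [StakeState.rotate]
  omega

theorem Params.card_active_le (X : Chain V D) : (P.stake X).active.card ≤ P.n := by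
  induction X with
  | nil => exact P.genesis_card.le
  | cons b X ih =>
    simp only [Params.stake]
    split_ifs
    · exact StakeState.card_rotate_le _ _ (by rwa [StakeState.foldl_apply_active])
    · rwa [StakeState.foldl_apply_active]

/-- The queue holds no duplicates, no active validator, and only validators that have entered. -/
structure StakeState.WellFormed (s : StakeState V) : Prop where
  nodup : s.queue.Nodup
  disj : ∀ v ∈ s.active, v ∉ s.queue
  active_seen : ∀ v ∈ s.active, v ∈ s.seen
  queue_seen : ∀ v ∈ s.queue, v ∈ s.seen

theorem StakeState.WellFormed.apply {s : StakeState V} (h : s.WellFormed) (t : Tx V) :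
    (s.apply t).WellFormed := by
  cases t with
  | stake v =>
    simp only [StakeState.apply]
    split_ifs with hv
    · exact h
    · refine ⟨?_, ?_, ?_, ?_⟩
      · exact h.nodup.append (List.nodup_singleton v) (by
          simpa using fun hq => hv (h.queue_seen v hq))
      · intro u hu
        simp only [List.mem_append, List.mem_singleton, not_or]
        exact ⟨h.disj u hu, fun e => hv (e ▸ h.active_seen u hu)⟩
      · exact fun u hu => Finset.mem_insert_of_mem (h.active_seen u hu)
      · intro u hu
        rcases List.mem_append.1 hu with hu | hu
        · exact Finset.mem_insert_of_mem (h.queue_seen u hu)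
        · rw [List.mem_singleton.1 hu]; exact Finset.mem_insert_self _ _
  | request v =>
    simp only [StakeState.apply]
    split_ifs
    · exact ⟨h.nodup, h.disj, h.active_seen, h.queue_seen⟩
    · exact h
  | withdraw v => exact h
  | other v => exact h

theorem StakeState.WellFormed.foldl {s : StakeState V} (h : s.WellFormed) (l : List (Tx V)) :
    (l.foldl StakeState.apply s).WellFormed := by
  induction l generalizing s with
  | nil => exact h
  | cons t l ih => exact ih (h.apply t)

theorem StakeState.WellFormed.rotate {s : StakeState V} (h : s.WellFormed) (n : ℕ) :
    (s.rotate n).WellFormed := by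
  refine ⟨h.nodup.sublist (List.drop_sublist _ _), ?_, ?_, ?_⟩
  · intro v hv hq
    simp only [StakeState.rotate, Finset.mem_union, Finset.mem_sdiff, List.mem_toFinset] at hv hq
    rcases hv with hv | hv
    · exact h.disj v hv.1 (List.mem_of_mem_drop hq)
    · exact List.disjoint_take_drop h.nodup le_rfl hv hq
  · intro v hv
    simp only [StakeState.rotate, Finset.mem_union, Finset.mem_sdiff, List.mem_toFinset] at hv ⊢
    rcases hv with hv | hv
    · exact h.active_seen v hv.1
    · exact h.queue_seen v (List.mem_of_mem_take hv)
  · exact fun v hv => h.queue_seen v (List.mem_of_mem_drop hv)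

theorem Params.stake_wellFormed (X : Chain V D) : (P.stake X).WellFormed := by
  induction X with
  | nil => exact ⟨List.nodup_nil, by simp [Params.stake], by simp [Params.stake], by simp [Params.stake]⟩
  | cons b X ih =>
    simp only [Params.stake]
    split_ifs
    · exact (ih.foldl _).rotate _
    · exact ih.foldl _

/-- The validator has left the active set for good. -/
structure StakeState.Gone (s : StakeState V) (v : V) : Prop where
  active : v ∉ s.active
  queue : v ∉ s.queue
  seen : v ∈ s.seen

/-- Departure is permanent because `seen` never shrinks: a validator recorded there cannot join the
queue again. -/
theorem StakeState.Gone.apply {s : StakeState V} {v : V} (h : s.Gone v) (t : Tx V) :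
    (s.apply t).Gone v := by
  cases t with
  | stake u =>
    simp only [StakeState.apply]
    split_ifs with hu
    · exact h
    · refine ⟨h.active, ?_, Finset.mem_insert_of_mem h.seen⟩
      simp only [List.mem_append, List.mem_singleton, not_or]
      exact ⟨h.queue, fun e => hu (e ▸ h.seen)⟩
  | request u =>
    simp only [StakeState.apply]
    split_ifs
    · exact ⟨h.active, h.queue, h.seen⟩
    · exact h
  | withdraw u => exact h
  | other u => exact h

theorem StakeState.Gone.foldl {s : StakeState V} {v : V} (h : s.Gone v) (l : List (Tx V)) :
    (l.foldl StakeState.apply s).Gone v := by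
  induction l generalizing s with
  | nil => exact h
  | cons t l ih => exact ih (h.apply t)

theorem StakeState.Gone.rotate {s : StakeState V} {v : V} (h : s.Gone v) (n : ℕ) :
    (s.rotate n).Gone v := by
  refine ⟨?_, fun hq => h.queue (List.mem_of_mem_drop hq), h.seen⟩
  simp only [StakeState.rotate, Finset.mem_union, Finset.mem_sdiff, List.mem_toFinset, not_or]
  exact ⟨fun hv => h.active hv.1, fun hv => h.queue (List.mem_of_mem_take hv)⟩

theorem StakeState.leaving_apply {s : StakeState V} {v : V} (h : v ∈ s.leaving) (t : Tx V) :
    v ∈ (s.apply t).leaving := by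
  cases t <;> simp only [StakeState.apply] <;> (try split_ifs) <;> simp [h]

theorem StakeState.leaving_foldl {s : StakeState V} {v : V} (h : v ∈ s.leaving)
    (l : List (Tx V)) : v ∈ (l.foldl StakeState.apply s).leaving := by
  induction l generalizing s with
  | nil => exact h
  | cons t l ih => exact ih (leaving_apply h t)

theorem StakeState.leaving_of_request {s : StakeState V} {v : V} (h : v ∈ s.active)
    {l : List (Tx V)} (hl : Tx.request v ∈ l) : v ∈ (l.foldl StakeState.apply s).leaving := by
  induction l generalizing s with
  | nil => simp at hl
  | cons t l ih =>
    rcases List.mem_cons.1 hl with rfl | hl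
    · refine leaving_foldl ?_ l
      simp [StakeState.apply, h]
    · exact ih (by rwa [StakeState.apply_active]) hl

/-- Well-formedness matters here: an active validator is not in the queue, so the rotation that
removes it cannot readmit it. -/
theorem StakeState.gone_rotate {s : StakeState V} {v : V} (hw : s.WellFormed) (h : v ∈ s.active)
    (hl : v ∈ s.leaving) (n : ℕ) : (s.rotate n).Gone v := by
  refine ⟨?_, fun hq => hw.disj v h (List.mem_of_mem_drop hq), hw.active_seen v h⟩
  simp only [StakeState.rotate, Finset.mem_union, Finset.mem_sdiff, List.mem_toFinset, not_or]
  exact ⟨fun hv => hv.2 hl, fun hv => hw.disj v h (List.mem_of_mem_take hv)⟩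

/-- After a request, the validator is leaving until the end of the epoch, and gone afterwards. -/
theorem Params.leaving_or_gone {b : Body V D} {Y X : Chain V D} {v : V}
    (hr : Tx.request v ∈ b.txs) (hv : v ∈ P.committee Y) (hX : b :: Y <:+ X) :
    (P.stake X).Gone v ∨ (X.length < P.m * P.epochOf (b :: Y) ∧ v ∈ (P.stake X).active ∧
      v ∈ (P.stake X).leaving) := by
  have hm := P.m_pos
  induction X with
  | nil => simp at hX
  | cons c X ih =>
    rcases List.suffix_cons_iff.1 hX with h | h
    · obtain ⟨rfl, rfl⟩ := List.cons_eq_cons.1 h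
      have hl := StakeState.leaving_of_request (s := P.stake Y) hv hr
      have ha : v ∈ (b.txs.foldl StakeState.apply (P.stake Y)).active := by
        rw [StakeState.foldl_apply_active]; exact hv
      simp only [Params.stake]
      split_ifs with hmod
      · exact Or.inl (StakeState.gone_rotate ((P.stake_wellFormed Y).foldl _) ha hl _)
      · refine Or.inr ⟨?_, ha, hl⟩
        simp only [Params.epochOf, List.length_cons, Nat.add_sub_cancel]
        -- `P.m * P.epochOf (b :: Y)` is the height of the last block of the epoch of the request; a
        -- height in this epoch that is not a multiple of `P.m` lies strictly below it.
        have h1 := Nat.lt_mul_div_succ Y.length hm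
        have h2 : Y.length + 1 ≠ P.m * (Y.length / P.m + 1) := fun e => hmod (by
          rw [e]; exact Nat.mul_mod_right _ _)
        omega
    · rcases ih h with hg | ⟨hlt, ha, hl⟩
      · left
        simp only [Params.stake]
        split_ifs
        · exact (hg.foldl _).rotate _
        · exact hg.foldl _
      · have hl' := StakeState.leaving_foldl hl c.txs
        have ha' : v ∈ (c.txs.foldl StakeState.apply (P.stake X)).active := by
          rwa [StakeState.foldl_apply_active]
        simp only [Params.stake]
        split_ifs with hmod
        · exact Or.inl (StakeState.gone_rotate ((P.stake_wellFormed X).foldl _) ha' hl' _)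
        · refine Or.inr ⟨?_, ha', hl'⟩
          have h2 : X.length + 1 ≠ P.m * P.epochOf (b :: Y) := fun e => hmod (by
            rw [e]; exact Nat.mul_mod_right _ _)
          simp only [List.length_cons]
          omega

/-- Links withdrawals to the scan: the checkpoint that permits a withdrawal reaches the end of the
epoch of the request, hence cannot lie inside a chain whose committee still contains the validator.
-/
theorem Params.not_mem_committee_of_request {b : Body V D} {Y X : Chain V D} {v : V}
    (hr : Tx.request v ∈ b.txs) (hv : v ∈ P.committee Y) (hX : b :: Y <:+ X)
    (hlen : P.m * P.epochOf (b :: Y) ≤ X.length) : v ∉ P.committee X := by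
  rcases P.leaving_or_gone hr hv hX with h | h
  · exact h.active
  · omega

/-- The active set is fixed during an epoch. -/
theorem Params.committee_eq_of_nextEpoch {L X : Chain V D} (h : L <:+ X)
    (he : P.nextEpoch X = P.nextEpoch L) : P.committee X = P.committee L := by
  have hm := P.m_pos
  induction X with
  | nil => rw [List.suffix_nil.1 h]
  | cons c X ih =>
    rcases List.suffix_cons_iff.1 h with h | h
    · rw [h]
    · have h1 : L.length / P.m ≤ X.length / P.m := Nat.div_le_div_right h.length_le
      have h2 : X.length / P.m ≤ (X.length + 1) / P.m := Nat.div_le_div_right (Nat.le_succ _)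
      simp only [Params.nextEpoch, List.length_cons, Nat.add_right_cancel_iff] at he ih
      -- A rotation at this height would increase the epoch number, which is the same at both ends.
      have h3 : (X.length + 1) % P.m ≠ 0 := by
        intro h0
        have e1 := Nat.div_add_mod (X.length + 1) P.m
        have e2 := Nat.lt_mul_div_succ X.length hm
        have e3 : X.length / P.m = (X.length + 1) / P.m := by omega
        have e4 := Nat.mul_div_le X.length P.m
        rw [← e3, h0] at e1
        omega
      rw [← ih h (by omega)]
      ext v
      simp only [Params.committee, Params.stake, if_neg h3, StakeState.foldl_apply_active]

end Stake

/-! ### Quorum intersection and accountable safety of Tendermint. -/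

section Tendermint

variable {V : Type u} {D : Type w} {n : ℕ} {M M' : Set (Vote V D)} {Q Q' : Set V} {B : BlockId D}

theorem Polka.mono (hM : M ⊆ M') (hQ : Q ⊆ Q') {r : ℕ} (h : Polka n M Q B r) :
    Polka n M' Q' B r := by
  induction h with
  | intro r S just sub quorum votes lt justified ih =>
    exact ⟨r, S, just, fun v hv => hQ (sub v hv), quorum, fun v hv => hM (votes v hv), lt, ih⟩

theorem Certifies.mono (hM : M ⊆ M') (hQ : Q ⊆ Q') (h : Certifies n M Q B) :
    Certifies n M' Q' B := by
  obtain ⟨r, S, sub, quorum, votes, polka⟩ := h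
  exact ⟨r, S, fun v hv => hQ (sub v hv), quorum, fun v hv => hM (votes v hv), polka.mono hM hQ⟩

theorem Violates.mono (hM : M ⊆ M') {v : V} (h : Violates M v) : Violates M' v := by
  obtain ⟨a, ha, b, hb, h⟩ := h
  exact ⟨a, hM ha, b, hM hb, h⟩

/-- The overlap has more than `2n/3 + 2n/3 - n = n/3` members. -/
theorem quorum_inter [DecidableEq V] {A S S' : Finset V} (hA : A.card ≤ n) (hS : S ⊆ A)
    (hS' : S' ⊆ A) (h : 2 * n < 3 * S.card) (h' : 2 * n < 3 * S'.card) :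
    n < 3 * (S ∩ S').card := by
  have h1 := Finset.card_union_add_card_inter S S'
  have h2 := Finset.card_le_card (Finset.union_subset hS hS')
  omega

/-- A quorum of prevotes that contradicts a quorum of precommits of the same or an earlier round
incriminates a third of the validators. -/
theorem violators_of_polka [DecidableEq V] {A : Finset V} (hA : A.card ≤ n) {B' : BlockId D}
    (hne : B ≠ B') (hh : B.height = B'.height) {r : ℕ} {S : Finset V} (hS : S ⊆ A)
    (hq : 2 * n < 3 * S.card) (hv : ∀ v ∈ S, (⟨v, r, B, .precommit⟩ : Vote V D) ∈ M)
    (hp : Polka n M {v | v ∈ A} B r) {r' : ℕ} (hp' : Polka n M {v | v ∈ A} B' r') (hr : r ≤ r') :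
    ∃ F : Finset V, F ⊆ A ∧ n < 3 * F.card ∧ ∀ v ∈ F, Violates M v := by
  induction hp' with
  | intro r' S' just sub quorum votes lt justified ih =>
    rcases hr.eq_or_lt with rfl | hr
    -- In equal rounds the precommits are not used: the prevote quorum behind them already
    -- intersects the conflicting one in double prevoters.
    · obtain ⟨_, S₀, just₀, sub₀, quorum₀, votes₀, _, _⟩ := hp
      refine ⟨S₀ ∩ S', Finset.inter_subset_left.trans sub₀, quorum_inter hA sub₀ sub quorum₀ quorum,
        fun v hv => ?_⟩
      rw [Finset.mem_inter] at hv
      exact ⟨_, votes₀ v hv.1, _, votes v hv.2, rfl, rfl, hh, hne, Or.inl ⟨rfl, _, _, rfl, rfl⟩⟩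
    -- Either some prevote rests on a quorum of a round `j ≥ r`, to which the argument descends, or
    -- none does, and then every validator that precommitted in `r` and prevoted here has broken its
    -- lock.
    · by_cases hj : ∃ v ∈ S', ∃ j, just v = some j ∧ r ≤ j
      · obtain ⟨v, hv, j, hj, hrj⟩ := hj
        exact ih v hv j hj hrj
      · push Not at hj
        refine ⟨S ∩ S', Finset.inter_subset_left.trans hS, quorum_inter hA hS sub hq quorum,
          fun v hvi => ?_⟩
        rw [Finset.mem_inter] at hvi
        exact ⟨_, hv v hvi.1, _, votes v hvi.2, rfl, rfl, hh, hne,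
          Or.inr (Or.inr ⟨hr, rfl, _, rfl, fun i hi => hj v hvi.2 i hi⟩)⟩

/-- Accountable safety of Tendermint. -/
theorem violators_of_certifies [DecidableEq V] {A : Finset V} (hA : A.card ≤ n) {B' : BlockId D}
    (hne : B ≠ B') (hh : B.height = B'.height) (h : Certifies n M {v | v ∈ A} B)
    (h' : Certifies n M {v | v ∈ A} B') :
    ∃ F : Finset V, F ⊆ A ∧ n < 3 * F.card ∧ ∀ v ∈ F, Violates M v := by
  obtain ⟨r, S, sub, quorum, votes, polka⟩ := h
  obtain ⟨r', S', sub', quorum', votes', polka'⟩ := h'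
  rcases le_total r r' with hr | hr
  · exact violators_of_polka hA hne hh sub quorum votes polka polka' hr
  · exact violators_of_polka hA hne.symm hh.symm sub' quorum' votes' polka' polka hr

end Tendermint

/-! ### Monotonicity of views and finalization. -/

section Views

variable {V : Type u} {D : Type w} {W W' : View V D}

theorem View.Sub.trans {W'' : View V D} (h : W.Sub W') (h' : W'.Sub W'') : W.Sub W'' :=
  ⟨h.1.trans h'.1, h.2.1.trans h'.2.1, h.2.2.trans h'.2.2⟩

theorem View.Sub.known (h : W.Sub W') : W.known ⊆ W'.known := by
  rintro a (ha | ⟨b, X, hX, ha⟩ | ⟨C, hC, t, ht, ha⟩)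
  · exact Or.inl (h.2.1 ha)
  · exact Or.inr (Or.inl ⟨b, X, h.1 hX, ha⟩)
  · exact Or.inr (Or.inr ⟨C, h.2.2 hC, t, ht, ha⟩)

theorem View.Available.mono (h : W.Sub W') {X : Chain V D} (hX : W.Available X) :
    W'.Available X := fun Y hY hne => h.1 (hX Y hY hne)

theorem View.Available.suffix {X Y : Chain V D} (hX : W.Available X) (hY : Y <:+ X) :
    W.Available Y := fun Z hZ hne => hX Z (hZ.trans hY) hne

theorem View.Available.chainVotes_subset {X : Chain V D} (hX : W.Available X) :
    chainVotes X ⊆ W.known := by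
  rintro a ⟨b, hb, ha⟩
  obtain ⟨s, t, rfl⟩ := List.append_of_mem hb
  exact Or.inr (Or.inl ⟨b, t, hX _ ⟨s, rfl⟩ (by simp), ha⟩)

/-- The two views contain no two chains with the same identifier. -/
def Params.Injective (P : Params V D) (W W' : View V D) : Prop :=
  ∀ Y Z, W.Available Y → W'.Available Z → P.blockId Y = P.blockId Z → Y = Z

theorem Params.Injective.symm {P : Params V D} (h : P.Injective W W') : P.Injective W' W :=
  fun Y Z hY hZ e => (h Z Y hZ hY e.symm).symm

variable [DecidableEq V] {P : Params V D}

theorem Params.ValidChain.suffix {X Y : Chain V D} (hX : P.ValidChain X) (hY : Y <:+ X) :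
    P.ValidChain Y := by
  induction X with
  | nil => rw [List.suffix_nil.1 hY]; trivial
  | cons b X ih =>
    rcases List.suffix_cons_iff.1 hY with rfl | hY
    · exact hX
    · cases X with
      | nil => rw [List.suffix_nil.1 hY]; trivial
      | cons c X => exact ih hX.2.2 hY

/-- A block below the tip carries its finalizing votes in its child, so only the tip needs `S`.
Hence a checkpoint of a tip is evidence about every ancestor as well. -/
theorem certifies_of_validChain {X Y : Chain V D} (hX : P.ValidChain X) {S : Set (Vote V D)}
    (hS : Certifies P.n S (P.signers X) (P.blockId X)) (hY : Y <:+ X) (hne : Y ≠ []) :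
    Certifies P.n (chainVotes X ∪ S) (P.signers Y) (P.blockId Y) := by
  rcases eq_or_ne Y X with rfl | hYX
  · exact hS.mono Set.subset_union_right subset_rfl
  · obtain ⟨b, hb⟩ := cons_suffix_of_ne hY hYX
    obtain ⟨c, Z, rfl⟩ := List.exists_cons_of_ne_nil hne
    have hmem : b ∈ X := hb.subset (by simp)
    exact (hX.suffix hb).2.1.mono (fun a ha => Or.inl ⟨b, hmem, ha⟩) subset_rfl

theorem Params.Finalized.mono (h : W.Sub W') {X : Chain V D} (hX : P.Finalized W X) :
    P.Finalized W' X :=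
  ⟨hX.1, hX.2.1.mono h, hX.2.2.1, hX.2.2.2.mono h.known subset_rfl⟩

theorem Params.Finalized.suffix {X Y : Chain V D} (hX : P.Finalized W X) (hY : Y <:+ X)
    (hne : Y ≠ []) : P.Finalized W Y :=
  ⟨hne, hX.2.1.suffix hY, hX.2.2.1.suffix hY,
    (certifies_of_validChain hX.2.2.1 hX.2.2.2 hY hne).mono
      (Set.union_subset hX.2.1.chainVotes_subset subset_rfl) subset_rfl⟩

theorem Params.AvailableFinal.mono (h : W.Sub W') {L X : Chain V D} {A : Set V}
    (hX : P.AvailableFinal W L A X) : P.AvailableFinal W' L A X :=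
  ⟨hX.1.mono h, hX.2.1, fun Y hY hne hL => (hX.2.2 Y hY hne hL).mono h.known subset_rfl⟩

theorem Params.Acceptable.mono (h : W.Sub W') {L X : Chain V D} {A : Set V}
    {cp : Checkpoint V D} (hX : P.Acceptable W L A cp X) : P.Acceptable W' L A cp X :=
  ⟨hX.1, hX.2.1.mono h, hX.2.2⟩

theorem Params.Acceptable.finalized {L X : Chain V D} {A : Set V} {cp : Checkpoint V D}
    (hL : L = [] ∨ P.Finalized W L) (hX : P.Acceptable W L A cp X) : P.Finalized W X := by
  obtain ⟨-, ⟨hav, hval, hcert⟩, hne, -, hLX⟩ := hX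
  by_cases hXL : X <:+ L
  · rw [hXL.eq_of_length_le hLX.length_le] at hne ⊢
    exact hL.resolve_left hne
  · exact ⟨hne, hav, hval, (hcert X List.suffix_rfl hne hXL).mono subset_rfl Set.sdiff_subset⟩

/-- A view holds finitely many blocks; this bound makes the fast finality walk terminate. -/
theorem Params.finite_finalized_length (W : View V D) :
    ∃ N, ∀ X, P.Finalized W X → X.length ≤ N :=
  ⟨W.blocks.sup List.length, fun X hX =>
    Finset.le_sup (f := List.length) (hX.2.1 X List.suffix_rfl hX.1)⟩

end Views

/-! ### The fast finality walk. -/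

section Walks

variable {V : Type u} {D : Type w} {fin : Chain V D → Prop}

theorem Walk.suffix {X Y : Chain V D} (h : Walk fin X Y) : X <:+ Y := by
  induction h with
  | done X h => exact List.suffix_rfl
  | step X Y b h uniq next ih => exact suffix_of_cons_suffix ih

theorem Walk.eq_or_fin {X Y : Chain V D} (h : Walk fin X Y) : Y = X ∨ fin Y := by
  induction h with
  | done X h => exact Or.inl rfl
  | step X Y b h uniq next ih =>
    rcases ih with rfl | ih
    · exact Or.inr h
    · exact Or.inr ih

theorem Walk.not_existsUnique {X Y : Chain V D} (h : Walk fin X Y) : ¬ ∃! b, fin (b :: Y) := by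
  induction h with
  | done X h => exact h
  | step X Y b h uniq next ih => exact ih

/-- The rule `normal` gives a walk only without a stall. This one supplies the chain that the
emergency rule checkpoints during a stall. -/
theorem Walk.exists_of_bounded {N : ℕ} (hN : ∀ X, fin X → X.length ≤ N) (X : Chain V D) :
    ∃ Y, Walk fin X Y := by
  induction hk : N - X.length generalizing X with
  | zero =>
    refine ⟨X, .done X fun ⟨b, hb, _⟩ => ?_⟩
    have := hN _ hb
    simp only [List.length_cons] at this
    omega
  | succ k ih =>
    by_cases h : ∃! b, fin (b :: X)
    · obtain ⟨b, hb, uniq⟩ := h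
      obtain ⟨Y, hY⟩ := ih (b :: X) (by simp only [List.length_cons]; omega)
      exact ⟨Y, .step X Y b hb uniq hY⟩
    · exact ⟨X, .done X h⟩

/-- A walk reaches every final chain above its start, unless there is a fork on the way. -/
theorem Walk.reaches {L Y X : Chain V D} (h : Walk fin L Y) (hLX : L <:+ X)
    (hX : ∀ Z, L <:+ Z → Z <:+ X → Z ≠ L → fin Z) :
    X <:+ Y ∨ ∃ Z b c, b ≠ c ∧ L <:+ Z ∧ fin (b :: Z) ∧ fin (c :: Z) := by
  induction h with
  | done L h =>
    rcases eq_or_ne L X with rfl | hne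
    · exact Or.inl List.suffix_rfl
    · obtain ⟨b, hb⟩ := cons_suffix_of_ne hLX hne
      have hfin := hX _ (List.suffix_cons b L) hb (by simp)
      by_contra hcon
      push Not at hcon
      refine h ⟨b, hfin, fun c hc => ?_⟩
      by_contra hcb
      exact hcon.2 L b c (Ne.symm hcb) List.suffix_rfl hfin hc
  | step L Y a ha uniq next ih =>
    rcases eq_or_ne L X with rfl | hne
    · exact Or.inl (suffix_of_cons_suffix next.suffix)
    · obtain ⟨b, hb⟩ := cons_suffix_of_ne hLX hne
      have hfin := hX _ (List.suffix_cons b L) hb (by simp)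
      obtain rfl := uniq b hfin
      refine (ih hb fun Z hZ hZX _ => hX Z (suffix_of_cons_suffix hZ) hZX ?_).imp_right ?_
      · rintro rfl
        exact cons_not_suffix_self hZ
      · rintro ⟨Z, c, d, hcd, hZ, h⟩
        exact ⟨Z, c, d, hcd, suffix_of_cons_suffix hZ, h⟩

end Walks

/-! ### Positions of protocol transactions in Bitcoin chains. -/

section Items

variable {V : Type u} {D : Type w}

theorem BtcChain.items_append (C C' : BtcChain V D) :
    ∃ l : List (ℕ × BtcTx V D), BtcChain.items (C ++ C') = C.items ++ l ∧
      ∀ x ∈ l, C.length ≤ x.1 := by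
  refine ⟨(C'.zipIdx C.length).flatMap fun p => p.1.txs.map fun t => (p.2, t), ?_, ?_⟩
  · simp [BtcChain.items, List.zipIdx_append]
  · intro x hx
    simp only [List.mem_flatMap, List.mem_map] at hx
    obtain ⟨p, hp, t, -, rfl⟩ := hx
    exact List.le_snd_of_mem_zipIdx hp

theorem BtcChain.items_prefix {C C' : BtcChain V D} (h : C <+: C') : C.items <+: C'.items := by
  obtain ⟨t, rfl⟩ := h
  obtain ⟨l, hl, -⟩ := items_append C t
  exact ⟨l, hl.symm⟩

theorem BtcChain.lt_length_of_mem_items {C : BtcChain V D} {x : ℕ × BtcTx V D}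
    (hx : x ∈ C.items) : x.1 < C.length := by
  simp only [BtcChain.items, List.mem_flatMap, List.mem_map] at hx
  obtain ⟨p, hp, t, -, rfl⟩ := hx
  simpa using List.snd_lt_of_mem_zipIdx hp

theorem BtcChain.has_of_mem_items {C : BtcChain V D} {x : ℕ × BtcTx V D}
    (hx : x ∈ C.items) : C.Has x.2 := by
  simp only [BtcChain.items, List.mem_flatMap, List.mem_map] at hx
  obtain ⟨p, hp, t, ht, rfl⟩ := hx
  exact ⟨p.1, List.fst_mem_of_mem_zipIdx hp, ht⟩

theorem BtcChain.items_pairwise (C : BtcChain V D) : C.items.Pairwise fun x y => x.1 ≤ y.1 := by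
  induction C using List.reverseRecOn with
  | nil => simp [BtcChain.items]
  | append_singleton C b ih =>
    have hC : BtcChain.items (C ++ [b]) = BtcChain.items C ++ b.txs.map fun t => (C.length, t) := by
      simp [BtcChain.items, List.zipIdx_append]
    rw [hC, List.pairwise_append]
    refine ⟨ih, ?_, ?_⟩
    · rw [List.pairwise_map]
      exact List.pairwise_of_forall fun _ _ => le_rfl
    · intro x hx y hy
      obtain ⟨t, -, rfl⟩ := List.mem_map.1 hy
      exact (lt_length_of_mem_items hx).le

theorem le_of_mem_prefix {C : BtcChain V D} {l : List (ℕ × BtcTx V D)} {x y : ℕ × BtcTx V D}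
    (h : l ++ [x] <+: C.items) (hy : y ∈ l ++ [x]) : y.1 ≤ x.1 := by
  have := (C.items_pairwise.sublist h.sublist)
  rw [List.pairwise_append] at this
  rcases List.mem_append.1 hy with hy | hy
  · exact this.2.2 y hy x (by simp)
  · rw [List.mem_singleton.1 hy]

theorem mem_of_concat_prefix {α : Type*} {l l' : List α} {x : α} (h : l ++ [x] <+: l') :
    x ∈ l' := h.subset (by simp)

/-- The items up to one at a position below the length of `C` are the same in all Bitcoin chains
that are comparable with `C`. -/
theorem prefix_items_of_lt {C C' : BtcChain V D} (h : C <+: C' ∨ C' <+: C)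
    {l : List (ℕ × BtcTx V D)} {x : ℕ × BtcTx V D} (hl : l ++ [x] <+: C'.items)
    (hx : x.1 < C.length) : l ++ [x] <+: C.items := by
  rcases h with ⟨t, rfl⟩ | h
  · obtain ⟨m, hm, hpos⟩ := BtcChain.items_append C t
    rw [hm] at hl
    refine List.prefix_of_prefix_length_le hl (List.prefix_append _ _) ?_
    -- Otherwise `x` belongs to the part contributed by `t`, whose positions are at least
    -- `C.length`.
    by_contra hlen
    push Not at hlen
    have := List.prefix_of_prefix_length_le (List.prefix_append C.items m) hl hlen.le
    have hC : C.items <+: l := by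
      rcases List.prefix_concat_iff.1 this with h | h
      · rw [h] at hlen; simp at hlen
      · exact h
    obtain ⟨q, rfl⟩ := hC
    rw [List.append_assoc, List.prefix_append_right_inj] at hl
    have := hpos x (hl.subset (by simp))
    omega
  · exact hl.trans (BtcChain.items_prefix h)

end Items

/-! ### The checkpoint scan: agreement between views, stalls, crossings. -/

section Scan

variable {V : Type u} {D : Type w} [DecidableEq V] {P : Params V D} {W W' : View V D}

/-- The scan of a list of Bitcoin transactions. -/
noncomputable def Params.run (P : Params V D) (W : View V D) (l : List (ℕ × BtcTx V D)) :
    ScanState V D :=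
  l.foldl (P.scanStep W) ⟨[], ∅, [], none⟩

theorem Params.run_concat (l : List (ℕ × BtcTx V D)) (x : ℕ × BtcTx V D) :
    P.run W (l ++ [x]) = P.scanStep W (P.run W l) x := by
  simp [Params.run]

theorem Params.scanStep_of_stalled {s : ScanState V D} {x : ℕ × BtcTx V D} {p : ℕ}
    (h : s.stalled = some p) : P.scanStep W s x = s := by
  simp [Params.scanStep, h]

/-- The possible effects of a checkpoint on an unstalled scan. -/
theorem Params.scanStep_checkpoint (W : View V D) {s : ScanState V D} (h : s.stalled = none)
    (p : ℕ) (cp : Checkpoint V D) :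
    (¬ P.ValidCheckpoint s.chain s.accused cp ∧ P.scanStep W s (p, .checkpoint cp) = s) ∨
    (P.ValidCheckpoint s.chain s.accused cp ∧ ∃ X, P.Acceptable W s.chain s.accused cp X ∧
      P.scanStep W s (p, .checkpoint cp) =
        { s with chain := X, accepted := s.accepted ++ [(p, X)] }) ∨
    (P.ValidCheckpoint s.chain s.accused cp ∧ (¬ ∃ X, P.Acceptable W s.chain s.accused cp X) ∧
      (∃ X, P.blockId X = cp.block ∧ P.AvailableFinal W s.chain s.accused X) ∧
      P.scanStep W s (p, .checkpoint cp) = s) ∨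
    (P.ValidCheckpoint s.chain s.accused cp ∧
      (¬ ∃ X, P.blockId X = cp.block ∧ P.AvailableFinal W s.chain s.accused X) ∧
      P.scanStep W s (p, .checkpoint cp) = { s with stalled := some p }) := by
  by_cases hv : P.ValidCheckpoint s.chain s.accused cp
  · by_cases ha : ∃ X, P.Acceptable W s.chain s.accused cp X
    · exact Or.inr (Or.inl ⟨hv, ha.choose, ha.choose_spec, by simp [Params.scanStep, h, hv, ha]⟩)
    · by_cases hf : ∃ X, P.blockId X = cp.block ∧ P.AvailableFinal W s.chain s.accused X
      · exact Or.inr (Or.inr (Or.inl ⟨hv, ha, hf, by simp [Params.scanStep, h, hv, ha, hf]⟩))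
      · exact Or.inr (Or.inr (Or.inr ⟨hv, hf, by simp [Params.scanStep, h, hv, ha, hf]⟩))
  · exact Or.inl ⟨hv, by simp [Params.scanStep, h, hv]⟩

theorem Params.scanStep_fraud (W : View V D) {s : ScanState V D} (h : s.stalled = none)
    (p : ℕ) (S : Finset (Vote V D)) : P.scanStep W s (p, .fraud S) =
      { s with accused := s.accused ∪ {v | Violates (S : Set (Vote V D)) v} } := by
  simp [Params.scanStep, h]

theorem Params.chain_suffix_scanStep (s : ScanState V D) (x : ℕ × BtcTx V D) :
    s.chain <:+ (P.scanStep W s x).chain := by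
  rcases hs : s.stalled with _ | p
  · obtain ⟨p, cp | S⟩ := x
    · rcases P.scanStep_checkpoint W hs p cp with ⟨_, h⟩ | ⟨_, X, hX, h⟩ | ⟨_, _, _, h⟩ | ⟨_, _, h⟩ <;>
        rw [h]
      exact hX.2.2.2.2
    · rw [P.scanStep_fraud W hs]
  · rw [P.scanStep_of_stalled hs]

theorem Params.run_append_of_stalled {l : List (ℕ × BtcTx V D)} {p : ℕ}
    (h : (P.run W l).stalled = some p) (m : List (ℕ × BtcTx V D)) :
    P.run W (l ++ m) = P.run W l := by
  induction m using List.reverseRecOn with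
  | nil => simp
  | append_singleton m x ih =>
    rw [← List.append_assoc, Params.run_concat, ih, P.scanStep_of_stalled h]

theorem Params.run_eq_of_stalled {l l' : List (ℕ × BtcTx V D)} (hl : l <+: l') {p : ℕ}
    (h : (P.run W l).stalled = some p) : P.run W l' = P.run W l := by
  obtain ⟨m, rfl⟩ := hl
  exact Params.run_append_of_stalled h m

theorem Params.run_unstalled_of_prefix {l l' : List (ℕ × BtcTx V D)} (hl : l <+: l')
    (h : (P.run W l').stalled = none) : (P.run W l).stalled = none := by
  rcases hs : (P.run W l).stalled with _ | p
  · rfl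
  · rw [Params.run_eq_of_stalled hl hs, hs] at h
    exact h

theorem Params.run_chain_suffix {l l' : List (ℕ × BtcTx V D)} (hl : l <+: l') :
    (P.run W l).chain <:+ (P.run W l').chain := by
  obtain ⟨m, rfl⟩ := hl
  induction m using List.reverseRecOn with
  | nil => simp
  | append_singleton m x ih =>
    rw [← List.append_assoc, Params.run_concat]
    exact ih.trans (Params.chain_suffix_scanStep _ _)

theorem Params.Acceptable.available {L X : Chain V D} {A : Set V} {cp : Checkpoint V D}
    (h : P.Acceptable W L A cp X) : W.Available X := h.2.1.1

/-- Validity of a checkpoint does not depend on the view, and its identifier has at most one opening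
in the two views. Once that chain is available and final, accepting or skipping depends on the chain
alone, so two views can disagree only through a stall. -/
theorem Params.scanStep_agree (hW : P.Injective W W') {s : ScanState V D} {x : ℕ × BtcTx V D}
    (h : (P.scanStep W s x).stalled = none) (h' : (P.scanStep W' s x).stalled = none) :
    P.scanStep W s x = P.scanStep W' s x := by
  rcases hs : s.stalled with _ | p
  · obtain ⟨p, cp | S⟩ := x
    · rcases P.scanStep_checkpoint W hs p cp with
        ⟨h1, e⟩ | ⟨h1, X, hX, e⟩ | ⟨h1, h2, ⟨X, hX, hXa⟩, e⟩ | ⟨_, _, e⟩ <;>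
      rcases P.scanStep_checkpoint W' hs p cp with
        ⟨h1', e'⟩ | ⟨h1', X', hX', e'⟩ | ⟨h1', h2', ⟨X', hX', hXa'⟩, e'⟩ | ⟨_, _, e'⟩ <;>
      first
        | exact absurd h1 h1'
        | exact absurd h1' h1
        | (rw [e] at h; simp at h; done)
        | (rw [e'] at h'; simp at h'; done)
        | (rw [e, e']; done)
        | skip
      · obtain rfl := hW X X' hX.available hX'.available (hX.1.trans hX'.1.symm)
        rw [e, e']
      · obtain rfl := hW X X' hX.available hXa'.1 (hX.1.trans hX'.symm)
        exact absurd ⟨X, hX', hXa', hX.2.2⟩ h2'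
      · obtain rfl := hW X X' hXa.1 hX'.available (hX.trans hX'.1.symm)
        exact absurd ⟨X, hX, hXa, hX'.2.2⟩ h2
    · rw [P.scanStep_fraud W hs, P.scanStep_fraud W' hs]
  · rw [P.scanStep_of_stalled hs, P.scanStep_of_stalled hs]

/-- A stall is the absence of an opening, and a larger view keeps every opening. -/
theorem Params.scanStep_mono (hW : W.Sub W') {s : ScanState V D} {x : ℕ × BtcTx V D}
    (h : (P.scanStep W s x).stalled = none) : (P.scanStep W' s x).stalled = none := by
  rcases hs : s.stalled with _ | p
  · obtain ⟨p, cp | S⟩ := x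
    · rcases P.scanStep_checkpoint W' hs p cp with
        ⟨h1', e'⟩ | ⟨h1', X', hX', e'⟩ | ⟨h1', h2', ⟨X', hX', hXa'⟩, e'⟩ | ⟨h1', h2', e'⟩
      · rw [e', hs]
      · rw [e']; exact hs
      · rw [e', hs]
      · rcases P.scanStep_checkpoint W hs p cp with
          ⟨h1, e⟩ | ⟨h1, X, hX, e⟩ | ⟨h1, h2, ⟨X, hX, hXa⟩, e⟩ | ⟨_, _, e⟩
        · exact absurd h1' h1
        · exact absurd ⟨X, hX.1, hX.2.1.mono hW⟩ h2'
        · exact absurd ⟨X, hX, hXa.mono hW⟩ h2'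
        · rw [e] at h; simp at h
    · rw [P.scanStep_fraud W' hs]; exact hs
  · rw [P.scanStep_of_stalled hs, hs] at h
    simp at h

theorem Params.run_agree (hW : P.Injective W W') {l : List (ℕ × BtcTx V D)}
    (h : (P.run W l).stalled = none) (h' : (P.run W' l).stalled = none) :
    P.run W l = P.run W' l := by
  induction l using List.reverseRecOn with
  | nil => rfl
  | append_singleton l x ih =>
    have e := ih (Params.run_unstalled_of_prefix (List.prefix_append _ _) h)
      (Params.run_unstalled_of_prefix (List.prefix_append _ _) h')
    rw [Params.run_concat] at h h'
    rw [← e] at h'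
    rw [Params.run_concat, Params.run_concat, ← e]
    exact Params.scanStep_agree hW h h'

theorem Params.run_mono (hinj : P.Injective W W') (hW : W.Sub W') {l : List (ℕ × BtcTx V D)}
    (h : (P.run W l).stalled = none) : (P.run W' l).stalled = none := by
  induction l using List.reverseRecOn with
  | nil => rfl
  | append_singleton l x ih =>
    have h0 := Params.run_unstalled_of_prefix (List.prefix_append _ _) h
    have e := Params.run_agree hinj h0 (ih h0)
    rw [Params.run_concat] at h ⊢
    rw [← e]
    exact Params.scanStep_mono hW h

/-- A stalled scan has met, without a stall, all transactions before the one that stalls it. -/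
theorem Params.exists_of_stalled {l : List (ℕ × BtcTx V D)} {p : ℕ}
    (h : (P.run W l).stalled = some p) : ∃ m t, m ++ [(p, t)] <+: l ∧
      (P.run W m).stalled = none ∧ (P.run W (m ++ [(p, t)])).stalled = some p ∧
      (P.run W l).chain = (P.run W m).chain := by
  induction l using List.reverseRecOn with
  | nil => simp [Params.run] at h
  | append_singleton l x ih =>
    rcases hs : (P.run W l).stalled with _ | q
    · obtain ⟨q, t | t⟩ := x
      · rcases P.scanStep_checkpoint W hs q t with ⟨_, e⟩ | ⟨_, X, hX, e⟩ | ⟨_, _, _, e⟩ | ⟨_, _, e⟩ <;>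
          have h' := h <;> rw [Params.run_concat, e] at h'
        · simp [hs] at h'
        · simp [hs] at h'
        · simp [hs] at h'
        · obtain rfl : q = p := by simpa using h'
          exact ⟨l, _, List.prefix_rfl, hs, h, by rw [Params.run_concat, e]⟩
      · rw [Params.run_concat, P.scanStep_fraud W hs] at h
        simp [hs] at h
    · have e := Params.run_append_of_stalled hs [x]
      rw [e] at h ⊢
      obtain ⟨m, t, hm, h1, h2, h3⟩ := ih h
      exact ⟨m, t, hm.trans (List.prefix_append _ _), h1, h2, h3⟩

theorem Params.run_chain_finalized (l : List (ℕ × BtcTx V D)) :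
    (P.run W l).chain = [] ∨ P.Finalized W (P.run W l).chain := by
  induction l using List.reverseRecOn with
  | nil => exact Or.inl rfl
  | append_singleton l x ih =>
    rw [Params.run_concat]
    rcases hs : (P.run W l).stalled with _ | q
    · obtain ⟨q, t | t⟩ := x
      · rcases P.scanStep_checkpoint W hs q t with ⟨_, e⟩ | ⟨_, X, hX, e⟩ | ⟨_, _, _, e⟩ | ⟨_, _, e⟩ <;>
          rw [e]
        · exact ih
        · exact Or.inr (hX.finalized ih)
        · exact ih
        · exact ih
      · rw [P.scanStep_fraud W hs]; exact ih
    · rw [P.scanStep_of_stalled hs]; exact ih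

theorem Params.exists_of_accepted {l : List (ℕ × BtcTx V D)} {p : ℕ} {Z : Chain V D}
    (h : (p, Z) ∈ (P.run W l).accepted) : ∃ m t, m ++ [(p, t)] <+: l ∧
      (P.run W (m ++ [(p, t)])).chain = Z := by
  induction l using List.reverseRecOn with
  | nil => simp [Params.run] at h
  | append_singleton l x ih =>
    have key : (p, Z) ∈ (P.run W l).accepted → ∃ m t, m ++ [(p, t)] <+: l ++ [x] ∧
        (P.run W (m ++ [(p, t)])).chain = Z := fun h => by
      obtain ⟨m, t, hm, h1⟩ := ih h
      exact ⟨m, t, hm.trans (List.prefix_append _ _), h1⟩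
    have h' := h
    rw [Params.run_concat] at h'
    rcases hs : (P.run W l).stalled with _ | q
    · obtain ⟨q, t | t⟩ := x
      · rcases P.scanStep_checkpoint W hs q t with ⟨_, e⟩ | ⟨_, X, hX, e⟩ | ⟨_, _, _, e⟩ | ⟨_, _, e⟩ <;>
          rw [e] at h'
        · exact key h'
        · rcases List.mem_append.1 h' with h' | h'
          · exact key h'
          · obtain ⟨rfl, rfl⟩ := Prod.mk.inj (List.mem_singleton.1 h')
            exact ⟨l, _, List.prefix_rfl, by rw [Params.run_concat, e]⟩
        · exact key h'
        · exact key h'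
      · rw [P.scanStep_fraud W hs] at h'; exact key h'
    · rw [P.scanStep_of_stalled hs] at h'; exact key h'

/-- The checkpoint `cp` in position `p`, after the transactions `m`, is the first one by which the
scan of `l` accepts a chain, `Z`, that is not a prefix of `Y`. -/
structure Params.Crosses (P : Params V D) (W : View V D) (l : List (ℕ × BtcTx V D))
    (Y : Chain V D) (m : List (ℕ × BtcTx V D)) (p : ℕ) (cp : Checkpoint V D)
    (Z : Chain V D) : Prop where
  isPrefix : m ++ [(p, .checkpoint cp)] <+: l
  unstalled : (P.run W m).stalled = none
  below : (P.run W m).chain <:+ Y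
  valid : P.ValidCheckpoint (P.run W m).chain (P.run W m).accused cp
  acceptable : P.Acceptable W (P.run W m).chain (P.run W m).accused cp Z
  next_unstalled : (P.run W (m ++ [(p, .checkpoint cp)])).stalled = none
  next_chain : (P.run W (m ++ [(p, .checkpoint cp)])).chain = Z
  above : ¬ Z <:+ Y

theorem Params.exists_crosses {l : List (ℕ × BtcTx V D)} {Y : Chain V D}
    (h : ¬ (P.run W l).chain <:+ Y) : ∃ m p cp Z, P.Crosses W l Y m p cp Z := by
  induction l using List.reverseRecOn with
  | nil => exact absurd List.nil_suffix h
  | append_singleton l x ih =>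
    by_cases hl : (P.run W l).chain <:+ Y
    · have h' := h
      rw [Params.run_concat] at h'
      rcases hs : (P.run W l).stalled with _ | q
      · obtain ⟨q, t | t⟩ := x
        · rcases P.scanStep_checkpoint W hs q t with
            ⟨_, e⟩ | ⟨hv, X, hX, e⟩ | ⟨_, _, _, e⟩ | ⟨_, _, e⟩ <;> rw [e] at h'
          · exact absurd hl h'
          · exact ⟨l, q, t, X, List.prefix_rfl, hs, hl, hv, hX, by rw [Params.run_concat, e]; exact hs,
              by rw [Params.run_concat, e], h'⟩
          · exact absurd hl h'
          · exact absurd hl h'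
        · rw [P.scanStep_fraud W hs] at h'; exact absurd hl h'
      · rw [P.scanStep_of_stalled hs] at h'; exact absurd hl h'
    · obtain ⟨m, p, cp, Z, hc⟩ := ih hl
      exact ⟨m, p, cp, Z, { hc with isPrefix := hc.isPrefix.trans (List.prefix_append _ _) }⟩

theorem Params.Crosses.available {l : List (ℕ × BtcTx V D)} {Y : Chain V D}
    {m : List (ℕ × BtcTx V D)} {p : ℕ} {cp : Checkpoint V D} {Z : Chain V D}
    (h : P.Crosses W l Y m p cp Z) : W.Available Z := h.acceptable.available

/-- The checkpoint is validated against the committee after the old checkpointed chain. The tip of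
`Z` is of the same epoch as the next block, and the active set is fixed in an epoch, so these are
the signers of `Z`. -/
theorem Params.Crosses.certifies {l : List (ℕ × BtcTx V D)} {Y : Chain V D}
    {m : List (ℕ × BtcTx V D)} {p : ℕ} {cp : Checkpoint V D} {Z : Chain V D}
    (h : P.Crosses W l Y m p cp Z) : P.blockId Z = cp.block ∧
      Certifies P.n (cp.sigs : Set (Vote V D)) (P.signers Z) cp.block := by
  obtain ⟨hid, -, hne, hep, hLZ⟩ := h.acceptable
  refine ⟨hid, h.valid.2.mono subset_rfl ?_⟩
  refine Set.sdiff_subset.trans ?_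
  obtain ⟨b, Z', rfl⟩ := List.exists_cons_of_ne_nil hne
  rcases List.suffix_cons_iff.1 hLZ with hL | hL
  · exact absurd (hL ▸ h.below) h.above
  · rw [Params.signers, List.tail_cons, Params.committee_eq_of_nextEpoch P hL]
    simpa [Params.epochOf, Params.nextEpoch] using hep

/-- A run that agrees with a crossing up to its checkpoint and is not stalled accepts its chain. -/
theorem Params.Crosses.run_chain {l : List (ℕ × BtcTx V D)} {Y : Chain V D}
    {m : List (ℕ × BtcTx V D)} {p : ℕ} {cp : Checkpoint V D} {Z : Chain V D}
    (h : P.Crosses W l Y m p cp Z) (hW : P.Injective W W')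
    (h' : (P.run W' (m ++ [(p, .checkpoint cp)])).stalled = none) :
    (P.run W' (m ++ [(p, .checkpoint cp)])).chain = Z := by
  rw [← Params.run_agree hW h.next_unstalled h', h.next_chain]

theorem concat_prefix_or {α : Type*} {l m m' : List α} {x : α} (hm : m ++ [x] <+: l)
    (hm' : m' <+: l) : m ++ [x] <+: m' ∨ m' <+: m := by
  rcases List.prefix_or_prefix_of_prefix hm hm' with h | h
  · exact Or.inl h
  · rcases List.prefix_concat_iff.1 h with h | h
    · exact Or.inl (h ▸ List.prefix_rfl)
    · exact Or.inr h

/-- If the second run had passed the crossing item of the first before its own crossing, it would,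
being unstalled, have accepted `Z` and no longer be below `Y`. -/
theorem Params.Crosses.prefix_of (hW : P.Injective W W') {l l' : List (ℕ × BtcTx V D)}
    {Y : Chain V D} {m m' : List (ℕ × BtcTx V D)} {p p' : ℕ} {cp cp' : Checkpoint V D}
    {Z Z' : Chain V D} (h : P.Crosses W l Y m p cp Z) (h' : P.Crosses W' l' Y m' p' cp' Z')
    (hl : l <+: l' ∨ l' <+: l) : m' <+: m := by
  have key : m ++ [(p, .checkpoint cp)] <+: m' → False := fun hp => by
    have hu := Params.run_unstalled_of_prefix hp h'.unstalled
    have hs := Params.run_chain_suffix (P := P) (W := W') hp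
    rw [h.run_chain hW hu] at hs
    exact h.above (hs.trans h'.below)
  have hm' := (List.prefix_append m' _).trans h'.isPrefix
  rcases hl with hl | hl
  · exact (concat_prefix_or (h.isPrefix.trans hl) hm').resolve_left key
  · exact (concat_prefix_or h.isPrefix (hm'.trans hl)).resolve_left key

/-- Makes the crossing of `Y` a global object, so that its depth in one client's Bitcoin chain can
be compared with the time at which another client sends evidence. -/
theorem Params.Crosses.unique (hW : P.Injective W W') {l l' : List (ℕ × BtcTx V D)}
    {Y : Chain V D} {m m' : List (ℕ × BtcTx V D)} {p p' : ℕ} {cp cp' : Checkpoint V D}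
    {Z Z' : Chain V D} (h : P.Crosses W l Y m p cp Z) (h' : P.Crosses W' l' Y m' p' cp' Z')
    (hl : l <+: l' ∨ l' <+: l) : m = m' ∧ p = p' ∧ cp = cp' ∧ Z = Z' := by
  have hm : m = m' := by
    have h1 := Params.Crosses.prefix_of hW h h' hl
    have h2 := Params.Crosses.prefix_of hW.symm h' h hl.symm
    exact h2.eq_of_length_le h1.length_le
  subst hm
  have he : m ++ [(p, BtcTx.checkpoint cp)] = m ++ [(p', BtcTx.checkpoint cp')] := by
    rcases hl with hl | hl
    · exact (List.prefix_of_prefix_length_le (h.isPrefix.trans hl) h'.isPrefix (by simp)).eq_of_length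
        (by simp)
    · exact (List.prefix_of_prefix_length_le h.isPrefix (h'.isPrefix.trans hl) (by simp)).eq_of_length
        (by simp)
  simp only [List.append_cancel_left_eq, List.cons.injEq, Prod.mk.injEq, BtcTx.checkpoint.injEq,
    and_true] at he
  obtain ⟨rfl, rfl⟩ := he
  exact ⟨rfl, rfl, rfl, hW Z Z' h.available h'.available
    (h.acceptable.1.trans h'.acceptable.1.symm)⟩

/-- The first crossing is no later than the given acceptance, hence at least as deep in the Bitcoin
chain. -/
theorem Params.exists_crosses_of_accepted {C : BtcChain V D} {Y : Chain V D} {p : ℕ}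
    {Z : Chain V D} (h : (p, Z) ∈ (P.run W C.items).accepted) (hZ : ¬ Z <:+ Y) :
    ∃ m q cp Z', q ≤ p ∧ P.Crosses W C.items Y m q cp Z' := by
  obtain ⟨m, t, hm, rfl⟩ := Params.exists_of_accepted h
  obtain ⟨m', q, cp, Z', hc⟩ := Params.exists_crosses hZ
  exact ⟨m', q, cp, Z', le_of_mem_prefix hm (mem_of_concat_prefix hc.isPrefix),
    { hc with isPrefix := hc.isPrefix.trans hm }⟩

end Scan

/-! ### Regular executions: timing, honest votes, checkpointed chains and outputs. -/

section Exec

variable {V : Type u} {X : Type v} {D : Type w} [DecidableEq V]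
  {E : Execution V X D} {P : Params V D} {T : ℕ}

/-- An execution of the protocol in which none of the exceptional events happens. -/
structure Execution.Regular (E : Execution V X D) (P : Params V D) (T : ℕ) : Prop where
  babylon : E.IsBabylon P
  active : E.HonestActive P
  hash : E.NoCollision P
  sig : E.NoForgery
  bitcoin : E.BitcoinSecure P T
  latency : 2 * P.Δ ≤ T

/-- The conclusion of slashable safety after a safety violation. -/
def Execution.ThirdSlashable (E : Execution V X D) (P : Params V D) : Prop :=
  ∃ (S : Finset V) (R : ℕ), (P.n / 3 : ℝ) ≤ S.card ∧ ∀ v ∈ S, v ∉ E.honest R ∧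
    ∀ c r, R ≤ r → E.Live c r → E.Slashable P c r v

namespace Execution.Regular

variable (h : E.Regular P T)
include h

theorem honest_of_le {v : V} {r s : ℕ} (hv : v ∈ E.honest s) (hrs : r ≤ s) : v ∈ E.honest r :=
  h.babylon.network.honest_antitone r s hrs hv

theorem exists_honest (r : ℕ) : ∃ v, v ∈ E.honest r :=
  let ⟨v, hv, _⟩ := h.active r
  ⟨v, hv⟩

/-- Two hops of `Δ` slots through a validator honest at `r'`; corruption is permanent, so it was
honest at the relay slot too. -/
theorem view_sub {c c' : Client V X} {r r' : ℕ} (hc : E.Live c r) (hc' : E.Live c' r')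
    (hr : r + 2 * P.Δ ≤ r') : (E.view c r).Sub (E.view c' r') := by
  obtain ⟨v, hv⟩ := h.exists_honest r'
  have hv' : v ∈ E.honest (r + P.Δ) := h.honest_of_le hv (by omega)
  exact (h.babylon.network.to_validators c r v _ hc hv' le_rfl).trans
    (h.babylon.network.from_validators v _ c' r' hv' hc' (by omega))

theorem injective {c c' : Client V X} {r r' : ℕ} (hc : E.Live c r) (hc' : E.Live c' r') :
    P.Injective (E.view c r) (E.view c' r') := h.hash c r c' r' hc hc'

theorem items_comparable {c c' : Client V X} {r r' : ℕ} (hc : E.Live c r) (hc' : E.Live c' r') :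
    (E.btc P c r).items <+: (E.btc P c' r').items ∨
      (E.btc P c' r').items <+: (E.btc P c r).items :=
  (h.bitcoin.consistent c r c' r' hc hc').imp BtcChain.items_prefix BtcChain.items_prefix

omit [DecidableEq V] h in
theorem length_btc (c : Client V X) (r : ℕ) :
    (E.btc P c r).length = (E.longest c r).length - P.depth := by
  simp [Execution.btc]

/-- The larger view contains the longest chain of the smaller one, and all clients cut off the same
number of blocks. -/
theorem btc_length_le_of_sub {c c' : Client V X} {r r' : ℕ} (hc : E.Live c r)
    (hc' : E.Live c' r') (hs : (E.view c r).Sub (E.view c' r')) :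
    (E.btc P c r).length ≤ (E.btc P c' r').length := by
  have := h.babylon.network.longest_max c' r' hc' _
    (hs.2.2 (h.babylon.network.longest_mem c r hc))
  rw [length_btc, length_btc]
  omega

theorem btc_prefix_to {c : Client V X} {v : V} {r s : ℕ} (hc : E.Live c r) (hv : v ∈ E.honest s)
    (hr : r + P.Δ ≤ s) : E.btc P c r <+: E.btc P (.inl v) s :=
  prefix_of_comparable (h.bitcoin.consistent _ _ _ _ hc hv)
    (h.btc_length_le_of_sub (c' := .inl v) hc hv
      (h.babylon.network.to_validators c r v s hc hv hr))

theorem btc_prefix_from {c : Client V X} {v : V} {r s : ℕ} (hv : v ∈ E.honest r)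
    (hc : E.Live c s) (hr : r + P.Δ ≤ s) : E.btc P (.inl v) r <+: E.btc P c s :=
  prefix_of_comparable (h.bitcoin.consistent (.inl v) r _ _ hv hc)
    (h.btc_length_le_of_sub (c := .inl v) hv hc
      (h.babylon.network.from_validators v r c s hv hc hr))

theorem btc_length_mono {v : V} {r s : ℕ} (hv : v ∈ E.honest s) (hr : r ≤ s) :
    (E.btc P (.inl v) r).length ≤ (E.btc P (.inl v) s).length :=
  (h.bitcoin.monotone (.inl v) r s hr (h.honest_of_le hv hr) hv).length_le

theorem items_zero {c : Client V X} (hc : E.Live c 0) : (E.btc P c 0).items = [] := by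
  rw [List.eq_nil_iff_forall_not_mem]
  intro x hx
  obtain ⟨b, hb, ht⟩ := BtcChain.has_of_mem_items hx
  have := h.babylon.network.btc_start c _ (h.babylon.network.longest_mem c 0 hc) b
    (List.mem_of_mem_take hb)
  simp [this] at ht

/-- No client has a position of a protocol transaction in its confirmed chain at slot `0`. -/
theorem length_zero_le {c c' : Client V X} {r : ℕ} (hc : E.Live c 0) (hc' : E.Live c' r)
    {l : List (ℕ × BtcTx V D)} {x : ℕ × BtcTx V D} (hl : l ++ [x] <+: (E.btc P c' r).items) :
    (E.btc P c 0).length ≤ x.1 := by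
  by_contra hlt
  have := prefix_items_of_lt (h.bitcoin.consistent c 0 c' r hc hc') hl (by omega)
  rw [h.items_zero hc] at this
  simp at this

/-- A transaction is in a confirmed chain unless this chain is too short. -/
theorem has_or_length_le {c c' : Client V X} {s s' : ℕ} {t : BtcTx V D} (hc : E.Live c s)
    (ht : t ∈ E.sent c s) {v : V} (hv : v ∈ E.honest (s + T)) (hc' : E.Live c' s') :
    (E.btc P c' s').Has t ∨
      ((E.btc P c' s').length ≤ (E.btc P (.inl v) (s + T)).length ∧
        (E.btc P c' s').length ≤ (E.btc P (.inl v) (s - 3 * P.Δ)).length + P.k) := by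
  have hg := h.bitcoin.growth c s t hc ht (.inl v) (h.honest_of_le hv (by omega)) hv
  by_cases hl : (E.btc P c' s').length ≤ (E.btc P (.inl v) (s + T)).length
  · exact Or.inr ⟨hl, hl.trans hg⟩
  · left
    obtain ⟨b, hb, hbt⟩ := h.bitcoin.live c s t hc ht (.inl v) (s + T) hv le_rfl
    have := prefix_of_comparable (h.bitcoin.consistent (.inl v) (s + T) c' s' hv hc') (by omega)
    exact ⟨b, this.subset hb, hbt⟩

/-- An honest validator cannot be accused. -/
theorem not_violates {v : V} {c : Client V X} {r : ℕ} (hv : v ∈ E.honest r) (hc : E.Live c r) :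
    ¬ Violates (E.view c r).known v := by
  rintro ⟨a, ha, b, hb, hav, hbv, hh, hne, hcase⟩
  obtain ⟨s, hs, has⟩ := h.sig c r hc a ha (hav ▸ hv)
  obtain ⟨s', hs', hbs⟩ := h.sig c r hc b hb (hbv ▸ hv)
  rw [hav] at has
  rw [hbv] at hbs
  have hvs := h.honest_of_le hv hs
  have hvs' := h.honest_of_le hv hs'
  have R := h.babylon.validators
  rcases hcase with ⟨hr, i, j, hi, hj⟩ | ⟨hr, hi, hj⟩ | ⟨hr, hi, j, hj, hlt⟩
  · exact hne (R.one_prevote v s s' hvs hvs' a has b hbs hh hr i j hi hj)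
  · exact hne (R.one_precommit v s s' hvs hvs' a has b hbs hh hr hi hj)
  · rcases le_or_gt s s' with hss | hss
    · rcases R.locking v s s' hvs hvs' hss a has b hbs hh hr hi j hj with e | ⟨i, hji, hle⟩
      · exact hne e
      · have := hlt i hji
        omega
    -- A prevote of a higher round signed before the precommit would violate the monotonicity of
    -- rounds.
    · have := R.rounds v s' s hvs' hvs hss b hbs a has hh.symm
      omega

omit h in
theorem scan_eq (c : Client V X) (r : ℕ) :
    E.scan P c r = P.run (E.view c r) (E.btc P c r).items := rfl

theorem run_unstalled_mono {c c' : Client V X} {r r' : ℕ} (hc : E.Live c r) (hc' : E.Live c' r')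
    (hs : (E.view c r).Sub (E.view c' r')) {l : List (ℕ × BtcTx V D)}
    (hl : (P.run (E.view c r) l).stalled = none) : (P.run (E.view c' r') l).stalled = none :=
  Params.run_mono (h.injective hc hc') hs hl

omit h in
/-- The state of a scan comes from an unstalled run. -/
theorem exists_unstalled_run (W : View V D) (l : List (ℕ × BtcTx V D)) :
    ∃ m, m <+: l ∧ (P.run W m).stalled = none ∧ (P.run W m).chain = (P.run W l).chain := by
  rcases hs : (P.run W l).stalled with _ | p
  · exact ⟨l, List.prefix_rfl, hs, rfl⟩
  · obtain ⟨m, t, hm, h1, -, h2⟩ := Params.exists_of_stalled hs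
    exact ⟨m, (List.prefix_append _ _).trans hm, h1, h2.symm⟩

theorem run_chain_comparable {c c' : Client V X} {r r' : ℕ} (hc : E.Live c r)
    (hc' : E.Live c' r') {l l' : List (ℕ × BtcTx V D)} (hl : l <+: l' ∨ l' <+: l) :
    (P.run (E.view c r) l).chain <:+ (P.run (E.view c' r') l').chain ∨
      (P.run (E.view c' r') l').chain <:+ (P.run (E.view c r) l).chain := by
  obtain ⟨m, hm, hu, e⟩ := exists_unstalled_run (P := P) (E.view c r) l
  obtain ⟨m', hm', hu', e'⟩ := exists_unstalled_run (P := P) (E.view c' r') l'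
  rw [← e, ← e']
  have hmm : m <+: m' ∨ m' <+: m := by
    rcases hl with hl | hl
    · exact List.prefix_or_prefix_of_prefix (hm.trans hl) hm'
    · exact List.prefix_or_prefix_of_prefix hm (hm'.trans hl)
  rcases hmm with hmm | hmm
  · left
    rw [Params.run_agree (h.injective hc hc') hu (Params.run_unstalled_of_prefix hmm hu')]
    exact Params.run_chain_suffix hmm
  · right
    rw [Params.run_agree (h.injective hc' hc) hu' (Params.run_unstalled_of_prefix hmm hu)]
    exact Params.run_chain_suffix hmm

/-- The checkpointed chains of the clients are comparable. -/
theorem scan_chain_comparable {c c' : Client V X} {r r' : ℕ} (hc : E.Live c r)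
    (hc' : E.Live c' r') : (E.scan P c r).chain <:+ (E.scan P c' r').chain ∨
      (E.scan P c' r').chain <:+ (E.scan P c r).chain :=
  h.run_chain_comparable hc hc' (h.items_comparable hc hc')

/-- The checkpointed chain of a client grows. -/
theorem scan_chain_mono {c : Client V X} {r r' : ℕ} (hr : r ≤ r') (hc : E.Live c r)
    (hc' : E.Live c r') : (E.scan P c r).chain <:+ (E.scan P c r').chain := by
  obtain ⟨m, hm, hu, e⟩ := exists_unstalled_run (P := P) (E.view c r) (E.btc P c r).items
  have hs := h.babylon.network.view_mono c r r' hr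
  rw [scan_eq, ← e,
    Params.run_agree (h.injective hc hc') hu (h.run_unstalled_mono hc hc' hs hu)]
  exact Params.run_chain_suffix
    (hm.trans (BtcChain.items_prefix (h.bitcoin.monotone c r r' hr hc hc')))

theorem scan_chain_suffix_out {c : Client V X} {r : ℕ} (hc : E.Live c r) :
    (E.scan P c r).chain <:+ E.out c r := by
  have R := h.babylon.clients
  by_cases hs : (E.scan P c r).stalled = none
  · exact (R.normal c r hc hs).suffix
  · by_cases hp : (E.scan P c r).chain <:+ E.prevOut c r
    · rwa [R.frozen c r hc hs hp]
    · rw [R.reset c r hc hs hp]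

omit h in
theorem scan_chain_finalized (c : Client V X) (r : ℕ) : (E.scan P c r).chain = [] ∨
    P.Finalized (E.view c r) (E.scan P c r).chain := Params.run_chain_finalized _

theorem out_finalized (c : Client V X) (r : ℕ) :
    E.out c r = [] ∨ P.Finalized (E.view c r) (E.out c r) := by
  have R := h.babylon.clients
  induction r with
  | zero =>
    by_cases hc : E.Live c 0
    · by_cases hs : (E.scan P c 0).stalled = none
      · rcases (R.normal c 0 hc hs).eq_or_fin with e | hf
        · rw [e]; exact scan_chain_finalized c 0
        · exact Or.inr hf
      · by_cases hp : (E.scan P c 0).chain <:+ E.prevOut c 0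
        · rw [R.frozen c 0 hc hs hp]; exact Or.inl rfl
        · rw [R.reset c 0 hc hs hp]; exact scan_chain_finalized c 0
    · rw [R.offline c 0 hc]; exact Or.inl rfl
  | succ r ih =>
    have ih' : E.prevOut c (r + 1) = [] ∨ P.Finalized (E.view c (r + 1)) (E.prevOut c (r + 1)) :=
      ih.imp_right (Params.Finalized.mono (h.babylon.network.view_mono c r (r + 1) (by omega)))
    by_cases hc : E.Live c (r + 1)
    · by_cases hs : (E.scan P c (r + 1)).stalled = none
      · rcases (R.normal c (r + 1) hc hs).eq_or_fin with e | hf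
        · rw [e]; exact scan_chain_finalized c (r + 1)
        · exact Or.inr hf
      · by_cases hp : (E.scan P c (r + 1)).chain <:+ E.prevOut c (r + 1)
        · rw [R.frozen c (r + 1) hc hs hp]; exact ih'
        · rw [R.reset c (r + 1) hc hs hp]; exact scan_chain_finalized c (r + 1)
    · rw [R.offline c (r + 1) hc]; exact ih'

theorem finalized_of_suffix_out {c : Client V X} {r : ℕ} {Y : Chain V D} (hY : Y <:+ E.out c r)
    (hne : Y ≠ []) : P.Finalized (E.view c r) Y := by
  rcases h.out_finalized c r with e | hf
  · rw [e, List.suffix_nil] at hY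
    exact absurd hY hne
  · exact hf.suffix hY hne

/-- A block of the output that is not checkpointed has been output by the fast finality rule. -/
theorem exists_normal {c : Client V X} {r : ℕ} (hc : E.Live c r) {Y : Chain V D} {b : Body V D}
    (hb : b :: Y <:+ E.out c r) (hL : (E.scan P c r).chain <:+ Y) :
    ∃ s ≤ r, E.Live c s ∧ (E.scan P c s).stalled = none ∧ b :: Y <:+ E.out c s ∧
      (E.scan P c s).chain <:+ Y := by
  have R := h.babylon.clients
  -- Offline and frozen slots only copy the previous output, and a reset outputs a checkpointed
  -- chain, which is inside `Y`. The block therefore goes back to a slot of the normal rule.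
  have key : ∀ s ≤ r, b :: Y <:+ E.out c s → ∃ s' ≤ s, E.Live c s' ∧
      (E.scan P c s').stalled = none ∧ b :: Y <:+ E.out c s' := by
    intro s
    induction s with
    | zero =>
      intro hsr hbs
      have h0 : ¬ b :: Y <:+ E.prevOut c 0 := by simp [Execution.prevOut]
      by_cases hcs : E.Live c 0
      · refine ⟨0, le_rfl, hcs, ?_, hbs⟩
        by_contra hs
        by_cases hp : (E.scan P c 0).chain <:+ E.prevOut c 0
        · exact h0 (R.frozen c 0 hcs hs hp ▸ hbs)
        · rw [R.reset c 0 hcs hs hp] at hbs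
          exact cons_not_suffix_self ((hbs.trans (h.scan_chain_mono hsr hcs hc)).trans hL)
      · exact absurd (R.offline c 0 hcs ▸ hbs) h0
    | succ s ih =>
      intro hsr hbs
      have h0 : b :: Y <:+ E.prevOut c (s + 1) → ∃ s' ≤ s + 1, E.Live c s' ∧
          (E.scan P c s').stalled = none ∧ b :: Y <:+ E.out c s' := fun hp => by
        obtain ⟨s', hs', hx⟩ := ih (by omega) hp
        exact ⟨s', by omega, hx⟩
      by_cases hcs : E.Live c (s + 1)
      · by_cases hs : (E.scan P c (s + 1)).stalled = none
        · exact ⟨s + 1, le_rfl, hcs, hs, hbs⟩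
        · by_cases hp : (E.scan P c (s + 1)).chain <:+ E.prevOut c (s + 1)
          · exact h0 (R.frozen c _ hcs hs hp ▸ hbs)
          · rw [R.reset c _ hcs hs hp] at hbs
            exact absurd ((hbs.trans (h.scan_chain_mono hsr hcs hc)).trans hL)
              cons_not_suffix_self
      · exact h0 (R.offline c _ hcs ▸ hbs)
  obtain ⟨s, hs, hcs, hu, hbs⟩ := key r le_rfl hb
  exact ⟨s, hs, hcs, hu, hbs, (h.scan_chain_mono hs hcs hc).trans hL⟩

omit h in
/-- A member of the committee of `Y` may only withdraw after the scan has left `Y`, and the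
checkpoint by which it has left `Y` is `k` deep. -/
theorem exists_crosses_of_permitted {c : Client V X} {r : ℕ} {v : V} {Y : Chain V D}
    (hv : v ∈ P.committee Y) (hp : E.Permitted P c r v) : ∃ m p cp Z,
      P.Crosses (E.view c r) (E.btc P c r).items Y m p cp Z ∧
        p + P.k < (E.btc P c r).length := by
  obtain ⟨⟨b, Y₀, -, hreq, hv₀, i, Z, hacc, hZ, hlen, hk⟩, -⟩ := hp
  have hZY : ¬ Z <:+ Y := fun hZY =>
    P.not_mem_committee_of_request hreq hv₀ (hZ.trans hZY) (hlen.trans hZY.length_le) hv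
  obtain ⟨m, p, cp, Z', hpi, hcr⟩ := Params.exists_crosses_of_accepted hacc hZY
  exact ⟨m, p, cp, Z', hcr, by omega⟩

/-- Two final children of `Y` implicate a third of the committee of `Y`, unless withdrawals are
permitted to the implicated validators. -/
theorem thirdSlashable_of_fork {Y : Chain V D} {b b' : Body V D} (hbb : b ≠ b')
    {c₁ c₂ : Client V X} {r₁ r₂ : ℕ} (h₁ : E.Live c₁ r₁) (h₂ : E.Live c₂ r₂)
    (ha : (E.view c₁ r₁).Available (b :: Y)) (ha' : (E.view c₂ r₂).Available (b' :: Y))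
    {M : Set (Vote V D)} (hM : M ⊆ (E.view c₁ r₁).known ∪ (E.view c₂ r₂).known)
    (hcert : Certifies P.n M (P.committee Y) (P.blockId (b :: Y)))
    (hcert' : Certifies P.n M (P.committee Y) (P.blockId (b' :: Y)))
    (hperm : ∀ v c r, E.Live c r → v ∈ P.committee Y → Violates M v → ¬ E.Permitted P c r v) :
    E.ThirdSlashable P := by
  have hne : P.blockId (b :: Y) ≠ P.blockId (b' :: Y) := fun e => by
    have := h.hash c₁ r₁ c₂ r₂ h₁ h₂ _ _ ha ha' e
    exact hbb (List.cons_eq_cons.1 this).1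
  obtain ⟨F, hF, hcard, hviol⟩ :=
    violators_of_certifies (P.card_active_le Y) hne (by simp [Params.blockId]) hcert hcert'
  have hsub : ∀ c r, r₁ + r₂ + 2 * P.Δ ≤ r → E.Live c r → M ⊆ (E.view c r).known :=
    fun c r hr hc => hM.trans (Set.union_subset (h.view_sub h₁ hc (by omega)).known
      (h.view_sub h₂ hc (by omega)).known)
  -- A slot at which both views have reached every live client.
  refine ⟨F, r₁ + r₂ + 2 * P.Δ, ?_, fun v hv => ⟨fun hon => ?_, fun c r hr hc => ⟨?_, ?_⟩⟩⟩
  · have : (P.n : ℝ) < 3 * F.card := by exact_mod_cast hcard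
    linarith
  · exact h.not_violates (c := .inl v) hon hon
      ((hviol v hv).mono (hsub (.inl v) _ le_rfl hon))
  · exact (hviol v hv).mono (hsub c r hr hc)
  · rintro ⟨s, -, hcs, hp, -⟩
    exact hperm v c s hcs (hF hv) (hviol v hv) hp

end Execution.Regular

end Exec

/-! ### Safety violations: evidence arrives before withdrawals are permitted. -/

section Safety

variable {V : Type u} {X : Type v} {D : Type w} [DecidableEq V]
  {E : Execution V X D} {P : Params V D} {T : ℕ}

theorem stalled_none_or_le {W : View V D} {C : BtcChain V D} {m : List (ℕ × BtcTx V D)}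
    {y : ℕ × BtcTx V D} (hl : m ++ [y] <+: C.items) :
    (P.run W (m ++ [y])).stalled = none ∨ ∃ q ≤ y.1, (P.run W C.items).stalled = some q := by
  rcases hs : (P.run W (m ++ [y])).stalled with _ | q
  · exact Or.inl rfl
  · obtain ⟨m', t, hm', -⟩ := Params.exists_of_stalled hs
    exact Or.inr ⟨q, le_of_mem_prefix hl (mem_of_concat_prefix hm'),
      by rw [Params.run_eq_of_stalled hl hs, hs]⟩

namespace Execution.Regular

variable (h : E.Regular P T)
include h

theorem crosses_unique {c c' : Client V X} {r r' : ℕ} (hc : E.Live c r) (hc' : E.Live c' r')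
    {Y Z Z' : Chain V D} {m m' : List (ℕ × BtcTx V D)} {p p' : ℕ} {cp cp' : Checkpoint V D}
    (hx : P.Crosses (E.view c r) (E.btc P c r).items Y m p cp Z)
    (hx' : P.Crosses (E.view c' r') (E.btc P c' r').items Y m' p' cp' Z') :
    m = m' ∧ p = p' ∧ cp = cp' ∧ Z = Z' :=
  hx.unique (h.injective hc hc') hx' (h.items_comparable hc hc')

omit h in
theorem crosses_lt_length {c : Client V X} {r : ℕ}
    {Y Z : Chain V D} {m : List (ℕ × BtcTx V D)} {p : ℕ} {cp : Checkpoint V D}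
    (hx : P.Crosses (E.view c r) (E.btc P c r).items Y m p cp Z) : p < (E.btc P c r).length :=
  BtcChain.lt_length_of_mem_items (mem_of_concat_prefix hx.isPrefix)

/-- A client that is not stalled before a crossing has not seen the checkpoint of the crossing. -/
theorem length_le_of_normal {c c₀ : Client V X} {r r₀ t : ℕ} (hc : E.Live c r)
    (hc₀ : E.Live c₀ r₀) (hs : (E.scan P c r).stalled = none)
    {Y Z : Chain V D} (hY : (E.scan P c r).chain <:+ Y) {m : List (ℕ × BtcTx V D)} {p : ℕ}
    {cp : Checkpoint V D}
    (hx : P.Crosses (E.view c₀ r₀) (E.btc P c₀ r₀).items Y m p cp Z) {v : V}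
    (hv : v ∈ E.honest t) (ht : t + P.Δ ≤ r) : (E.btc P (.inl v) t).length ≤ p := by
  by_contra hlt
  have hlen := (h.btc_prefix_from hv hc ht).length_le
  have hp := prefix_items_of_lt (h.bitcoin.consistent c r c₀ r₀ hc hc₀) hx.isPrefix
    (by simp only; omega)
  have hsu := Params.run_chain_suffix (P := P) (W := E.view c r) hp
  rw [hx.run_chain (h.injective hc₀ hc) (Params.run_unstalled_of_prefix hp hs)] at hsu
  exact hx.above (hsu.trans hY)

/-- If the crossing item preceded the stall, the unstalled part of the scan would have accepted `Z`,
which is not inside `Y`. -/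
theorem stalled_le_of_crosses {c c₀ : Client V X} {r r₀ q : ℕ} (hc : E.Live c r)
    (hc₀ : E.Live c₀ r₀) (hs : (E.scan P c r).stalled = some q)
    {Y Z : Chain V D} (hY : (E.scan P c r).chain <:+ Y) {m : List (ℕ × BtcTx V D)} {p : ℕ}
    {cp : Checkpoint V D}
    (hx : P.Crosses (E.view c₀ r₀) (E.btc P c₀ r₀).items Y m p cp Z) : q ≤ p := by
  obtain ⟨m', t, hm', hu, -, hchain⟩ := Params.exists_of_stalled hs
  obtain ⟨C, hC, hC₀⟩ : ∃ C : BtcChain V D, (E.btc P c r).items <+: C.items ∧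
      (E.btc P c₀ r₀).items <+: C.items :=
    (h.items_comparable hc hc₀).elim (fun hp => ⟨_, hp, List.prefix_rfl⟩)
      fun hp => ⟨_, List.prefix_rfl, hp⟩
  rcases concat_prefix_or (hx.isPrefix.trans hC₀)
    ((List.prefix_append m' _).trans (hm'.trans hC)) with hp | hp
  · have hsu := Params.run_chain_suffix (P := P) (W := E.view c r) hp
    rw [hx.run_chain (h.injective hc₀ hc) (Params.run_unstalled_of_prefix hp hu), ← hchain] at hsu
    exact absurd (hsu.trans hY) hx.above
  · have hpp : m' ++ [(q, t)] <+: m ++ [(p, .checkpoint cp)] :=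
      List.prefix_of_prefix_length_le (hm'.trans hC) (hx.isPrefix.trans hC₀)
        (by simpa using hp.length_le)
    exact le_of_mem_prefix hx.isPrefix (mem_of_concat_prefix hpp)

/-- A fork that a client sees before the withdrawals of the committee can be enabled leads to a
fraud proof in time. -/
theorem thirdSlashable_of_seen_fork {c : Client V X} {r : ℕ} (hc : E.Live c r) {Y : Chain V D}
    {b b' : Body V D} (hbb : b ≠ b') (hb : P.Finalized (E.view c r) (b :: Y))
    (hb' : P.Finalized (E.view c r) (b' :: Y)) {v : V} (hv : v ∈ E.honest (r + T))
    (hcross : ∀ c' r' m p cp Z, E.Live c' r' →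
      P.Crosses (E.view c' r') (E.btc P c' r').items Y m p cp Z →
      (E.btc P (.inl v) (r - 3 * P.Δ)).length ≤ p) : E.ThirdSlashable P := by
  obtain ⟨s, hs, hcs, S, -, hsent, hS⟩ := h.babylon.clients.fraud c r hc _ _ hb hb'
    ⟨fork_not_suffix hbb List.suffix_rfl List.suffix_rfl,
      fork_not_suffix hbb.symm List.suffix_rfl List.suffix_rfl⟩
  refine h.thirdSlashable_of_fork hbb hc hc hb.2.1 hb'.2.1 Set.subset_union_left hb.2.2.2
    hb'.2.2.2 fun u c' r' hc' hu hviol hperm => ?_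
  obtain ⟨m, p, cp, Z, hx, hk⟩ := exists_crosses_of_permitted hu hperm
  rcases h.has_or_length_le hcs hsent (h.honest_of_le hv (by omega)) hc' with hhas | ⟨-, hlen⟩
  · exact hperm.2.1 ⟨S, hhas, hS u hviol⟩
  · have h1 := hcross c' r' m p cp Z hc' hx
    have h2 := h.btc_length_mono (v := v) (h.honest_of_le hv (by omega))
      (show s - 3 * P.Δ ≤ r - 3 * P.Δ by omega)
    omega

/-- A validator that is stalled `2Δ` slots after it has seen the position of the stall was, for
some position, stalled `2Δ` slots after it first saw it. -/
theorem exists_emergency {c₁ : Client V X} {r₁ N : ℕ} (h₁ : E.Live c₁ r₁)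
    (hs₁ : (E.scan P c₁ r₁).stalled = none) {v : V} (hv : v ∈ E.honest N) (t : ℕ) :
    t + 2 * P.Δ ≤ N → r₁ < t + P.Δ → ∀ p, (E.scan P (.inl v) (t + 2 * P.Δ)).stalled = some p →
    p < (E.btc P (.inl v) t).length →
    ∃ t' ≤ t, ∃ q ≤ p, r₁ < t' + P.Δ ∧ (E.scan P (.inl v) (t' + 2 * P.Δ)).stalled = some q ∧
      q < (E.btc P (.inl v) t').length ∧ ∀ s < t', (E.btc P (.inl v) s).length ≤ q := by
  induction t using Nat.strong_induction_on with
  | _ t ih =>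
  intro htN hr p hstall hp
  -- If `p` was confirmed earlier, at `s`, then the stall at `s + 2Δ` may be at a smaller position,
  -- whose first sight may be earlier still; hence the induction on the slot.
  by_cases hex : ∃ s < t, p < (E.btc P (.inl v) s).length
  · obtain ⟨s, hst, hps⟩ := hex
    have hvt : E.Live (.inl v : Client V X) (t + 2 * P.Δ) := h.honest_of_le hv htN
    have hvs : E.Live (.inl v : Client V X) (s + 2 * P.Δ) := h.honest_of_le hv (by omega)
    have hvs0 : v ∈ E.honest s := h.honest_of_le hv (by omega)
    obtain ⟨m, y, hm, -, hsy, -⟩ := Params.exists_of_stalled hstall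
    have hrs : r₁ < s + P.Δ := by
      by_contra hle
      have hlen := (h.btc_prefix_from hvs0 h₁ (show s + P.Δ ≤ r₁ by omega)).length_le
      have hpre := prefix_items_of_lt (h.bitcoin.consistent c₁ r₁ _ _ h₁ hvt) hm
        (by simp only; omega)
      have hu := h.run_unstalled_mono h₁ hvt
        (h.babylon.network.to_validators c₁ r₁ v _ h₁ hvt (by omega))
        (Params.run_unstalled_of_prefix hpre hs₁)
      rw [hu] at hsy
      simp at hsy
    have hlen := h.btc_length_mono (v := v) (r := s) (s := s + 2 * P.Δ) hvs (by omega)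
    have hpre := prefix_items_of_lt (h.bitcoin.consistent _ _ _ _ hvs hvt) hm
      (by simp only; omega)
    rcases stalled_none_or_le (P := P) (W := E.view (.inl v) (s + 2 * P.Δ)) hpre with hu | hq
    · have hu' := h.run_unstalled_mono hvs hvt
        (h.babylon.network.view_mono _ _ _ (by omega)) hu
      rw [hu'] at hsy
      simp at hsy
    · obtain ⟨q, hqp, hq⟩ := hq
      simp only at hqp
      obtain ⟨t', ht', q', hq', hrest⟩ := ih s hst (by omega) hrs q hq (by omega)
      exact ⟨t', by omega, q', by omega, hrest⟩
  · push Not at hex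
    exact ⟨t, le_rfl, p, le_rfl, hr, hstall, hp, hex⟩

/-- The emergency checkpoint of a stalled validator implicates the committee of the fork between
its chain and the chain accepted later. -/
theorem thirdSlashable_of_emergency {v : V} {t q N : ℕ} (hv : v ∈ E.honest N)
    (hN : t + 2 * P.Δ + T ≤ N)
    (hstall : (E.scan P (.inl v) (t + 2 * P.Δ)).stalled = some q)
    (hq : q < (E.btc P (.inl v) t).length) (hfirst : ∀ s < t, (E.btc P (.inl v) s).length ≤ q)
    {Y : Chain V D} {b b₀ : Body V D} (hbb : b ≠ b₀)
    (hb : P.Finalized (E.view (.inl v) (t + 2 * P.Δ)) (b :: Y))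
    (hY : (E.scan P (.inl v) (t + 2 * P.Δ)).chain <:+ Y) {c₀ : Client V X} {r₀ : ℕ}
    (hc₀ : E.Live c₀ r₀) {Z : Chain V D} {m : List (ℕ × BtcTx V D)} {p : ℕ} {cp : Checkpoint V D}
    (hx : P.Crosses (E.view c₀ r₀) (E.btc P c₀ r₀).items Y m p cp Z) (hb₀ : b₀ :: Y <:+ Z) :
    E.ThirdSlashable P := by
  have hΔ := P.Δ_pos
  have hT := h.latency
  have hvt : E.Live (.inl v : Client V X) (t + 2 * P.Δ) := h.honest_of_le hv (by omega)
  have hv0 : E.Live (.inl v : Client V X) 0 := h.honest_of_le hv (by omega)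
  have hvT : v ∈ E.honest (t + 2 * P.Δ + T) := h.honest_of_le hv hN
  -- The start of the growth interval is before `t`, since `Δ ≥ 1`. For `t = 0` the subtraction
  -- truncates to slot `0`, where no protocol transaction is on Bitcoin.
  have hshort : (E.btc P (.inl v) (t + 2 * P.Δ - 3 * P.Δ)).length ≤ q := by
    rcases Nat.eq_zero_or_pos t with rfl | ht
    · obtain ⟨m', y, hm', -⟩ := Params.exists_of_stalled hstall
      have := h.length_zero_le hv0 hvt hm'
      simp only at this
      omega
    · exact hfirst _ (by omega)
  obtain ⟨B, hB⟩ := Params.finite_finalized_length (P := P) (E.view (.inl v) (t + 2 * P.Δ))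
  obtain ⟨W, hW⟩ := Walk.exists_of_bounded hB (E.scan P (.inl v) (t + 2 * P.Δ)).chain
  rcases hW.reaches (hY.trans (List.suffix_cons b Y)) (fun A hA hAX hne => hb.suffix hAX (by
    rintro rfl
    exact hne (List.suffix_nil.1 hA).symm)) with hbW | ⟨A, a, a', haa, hA, ha, ha'⟩
  · have hWne : W ≠ [] := by
      rintro rfl
      simp at hbW
    have hWfin : P.Finalized (E.view (.inl v) (t + 2 * P.Δ)) W := by
      rcases hW.eq_or_fin with e | hf
      · exact absurd ((e ▸ hbW).trans hY) cons_not_suffix_self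
      · exact hf
    obtain ⟨S, hS, hScert, hsent⟩ := h.babylon.clients.emergency (.inl v) t q
      (h.honest_of_le hv (by omega)) hvt hq (fun s hs _ => hfirst s hs) hstall W hWne (Or.inr hW)
    have hZval : P.ValidChain Z := hx.acceptable.2.1.2.1
    obtain ⟨hZid, hZcert⟩ := hx.certifies
    have hcpknown : (cp.sigs : Set (Vote V D)) ⊆ (E.view c₀ r₀).known := fun a ha => by
      obtain ⟨B, hB, hBt⟩ := BtcChain.has_of_mem_items (mem_of_concat_prefix hx.isPrefix)
      exact Or.inr (Or.inr ⟨_, h.babylon.network.longest_mem c₀ r₀ hc₀, _,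
        ⟨B, List.mem_of_mem_take hB, hBt⟩, ha⟩)
    -- `M` consists of exactly the votes that `Implicated` examines for the two checkpoints.
    refine h.thirdSlashable_of_fork hbb hvt hc₀ hb.2.1 (hx.available.suffix hb₀)
      (M := chainVotes W ∪ S ∪ (chainVotes Z ∪ cp.sigs)) ?_ ?_ ?_ ?_
    · exact Set.union_subset_union (Set.union_subset hWfin.2.1.chainVotes_subset hS)
        (Set.union_subset hx.available.chainVotes_subset hcpknown)
    · exact (certifies_of_validChain hWfin.2.2.1 hScert hbW (by simp)).mono
        Set.subset_union_left subset_rfl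
    · rw [← hZid] at hZcert
      exact (certifies_of_validChain hZval hZcert hb₀ (by simp)).mono
        Set.subset_union_right subset_rfl
    · intro u c r hc hu hviol hperm
      obtain ⟨m', p', cp', Z', hx', hk⟩ := exists_crosses_of_permitted hu hperm
      obtain ⟨rfl, rfl, rfl, rfl⟩ := h.crosses_unique hc₀ hc hx hx'
      have hqp := h.stalled_le_of_crosses hvt hc₀ hstall hY hx
      have hgrow := h.bitcoin.growth _ _ _ hvt hsent (.inl v) (h.honest_of_le hv (by omega)) hvT
      -- From `t + 3Δ` on the client has the blocks of `W`, which the implication requires. Before,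
      -- its confirmed chain is a prefix of that of `v` at `t + 2Δ + T`, by `T ≥ 2Δ`, and this is
      -- too short for the permission.
      have hr : t + 3 * P.Δ ≤ r := by
        by_contra hlt
        have h1 := (h.btc_prefix_to hc (h.honest_of_le hv (by omega))
          (le_refl (r + P.Δ))).length_le
        have h2 := h.btc_length_mono hvT (show r + P.Δ ≤ t + 2 * P.Δ + T by omega)
        omega
      rcases h.has_or_length_le hvt hsent hvT hc with hhas | ⟨-, hlen⟩
      · exact hperm.2.2 ⟨_, cp, W, Z, hhas,
          BtcChain.has_of_mem_items (mem_of_concat_prefix hx'.isPrefix), rfl, hZid,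
          hWfin.2.1.mono (h.babylon.network.from_validators v _ c r hvt hc (by omega)),
          hx'.available, hWfin.2.2.1, hZval, hScert, hZcert,
          ⟨fork_not_suffix hbb hbW hb₀, fork_not_suffix hbb.symm hb₀ hbW⟩, hviol⟩
      · omega
  · refine h.thirdSlashable_of_seen_fork hvt haa ha ha' hvT fun c' r' m' p' cp' Z' hc' hx' => ?_
    exact hshort.trans (h.stalled_le_of_crosses hvt hc' hstall hA hx')

/-- An output of the fast finality rule that conflicts with a checkpoint accepted later. -/
theorem thirdSlashable_of_crosses {c₁ : Client V X} {r₁ : ℕ} (h₁ : E.Live c₁ r₁)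
    (hs₁ : (E.scan P c₁ r₁).stalled = none) {Y : Chain V D} {b b₀ : Body V D} (hbb : b ≠ b₀)
    (hb : b :: Y <:+ E.out c₁ r₁) (hY : (E.scan P c₁ r₁).chain <:+ Y) {c₀ : Client V X} {r₀ : ℕ}
    (hc₀ : E.Live c₀ r₀) {Z : Chain V D} {m : List (ℕ × BtcTx V D)} {p : ℕ} {cp : Checkpoint V D}
    (hx : P.Crosses (E.view c₀ r₀) (E.btc P c₀ r₀).items Y m p cp Z) (hb₀ : b₀ :: Y <:+ Z) :
    E.ThirdSlashable P := by
  have hΔ := P.Δ_pos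
  -- Late enough for `t + 2Δ + T`, because `v` confirms the crossing by `r₀ + Δ`.
  obtain ⟨v, hv⟩ := h.exists_honest (r₀ + 3 * P.Δ + T)
  have hv0 : E.Live (.inl v : Client V X) 0 := h.honest_of_le hv (by omega)
  have hex : ∃ t, p < (E.btc P (.inl v) t).length := ⟨r₀ + P.Δ, (crosses_lt_length hx).trans_le
    (h.btc_prefix_to hc₀ (h.honest_of_le hv (by omega)) le_rfl).length_le⟩
  classical
  obtain ⟨t, ht, hmin⟩ : ∃ t, p < (E.btc P (.inl v) t).length ∧
      ∀ s < t, (E.btc P (.inl v) s).length ≤ p :=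
    ⟨Nat.find hex, Nat.find_spec hex, fun s hs => not_lt.1 (Nat.find_min hex hs)⟩
  have htr : t ≤ r₀ + P.Δ := by
    by_contra hlt
    have h1 := hmin (r₀ + P.Δ) (by omega)
    have h2 := (h.btc_prefix_to hc₀ (v := v) (h.honest_of_le hv (by omega))
      (le_refl (r₀ + P.Δ))).length_le
    have h3 := crosses_lt_length hx
    omega
  have hr₁ : r₁ < t + P.Δ := by
    by_contra hle
    have := h.length_le_of_normal h₁ hc₀ hs₁ hY hx (v := v) (t := t)
      (h.honest_of_le hv (by omega)) (by omega)
    omega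
  have hvt : E.Live (.inl v : Client V X) (t + 2 * P.Δ) := h.honest_of_le hv (by omega)
  have hfin : ∀ s, r₁ < s + P.Δ → s ≤ t →
      P.Finalized (E.view (.inl v) (s + 2 * P.Δ)) (b :: Y) := fun s hs hst =>
    (h.finalized_of_suffix_out hb (by simp)).mono
      (h.babylon.network.to_validators c₁ r₁ v _ h₁ (h.honest_of_le hv (by omega)) (by omega))
  have hshort : (E.btc P (.inl v) (t + 2 * P.Δ - 3 * P.Δ)).length ≤ p := by
    rcases Nat.eq_zero_or_pos t with rfl | htpos
    · have := h.length_zero_le hv0 hc₀ hx.isPrefix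
      simp only at this
      omega
    · exact hmin _ (by omega)
  -- Still inside `Y` although `p` is confirmed means a stall at or before `p`; otherwise `v` has
  -- made the crossing itself and sees both children finalized.
  by_cases hL : (E.scan P (.inl v) (t + 2 * P.Δ)).chain <:+ Y
  · have hpre := prefix_items_of_lt (h.bitcoin.consistent _ _ _ _ hvt hc₀) hx.isPrefix
      (ht.trans_le (h.btc_length_mono hvt (by omega)))
    rcases stalled_none_or_le (P := P) (W := E.view (.inl v) (t + 2 * P.Δ)) hpre with hu | hq
    · have hsu := Params.run_chain_suffix (P := P) (W := E.view (.inl v) (t + 2 * P.Δ)) hpre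
      rw [hx.run_chain (h.injective hc₀ hvt) hu] at hsu
      exact absurd (hsu.trans hL) hx.above
    · obtain ⟨q, hqp, hq⟩ := hq
      obtain ⟨t', ht', q', -, hr', hstall, hlt, hfirst⟩ := h.exists_emergency h₁ hs₁ hv t
        (by omega) hr₁ q hq (lt_of_le_of_lt hqp ht)
      exact h.thirdSlashable_of_emergency hv (by omega) hstall hlt hfirst hbb (hfin t' hr' ht')
        ((h.scan_chain_mono (c := .inl v) (by omega)
          (h.honest_of_le (s := r₀ + 3 * P.Δ + T) hv (by omega)) hvt).trans hL) hc₀ hx hb₀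
  · obtain ⟨m', p', cp', Z', hx'⟩ := Params.exists_crosses hL
    obtain ⟨rfl, rfl, rfl, rfl⟩ := h.crosses_unique hc₀ hvt hx hx'
    have hZ := Params.run_chain_suffix (P := P) (W := E.view (.inl v) (t + 2 * P.Δ)) hx'.isPrefix
    rw [hx'.next_chain] at hZ
    have hb₀' : P.Finalized (E.view (.inl v) (t + 2 * P.Δ)) (b₀ :: Y) :=
      h.finalized_of_suffix_out (hb₀.trans (hZ.trans (h.scan_chain_suffix_out hvt))) (by simp)
    refine h.thirdSlashable_of_seen_fork hvt hbb (hfin t hr₁ le_rfl) hb₀'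
      (h.honest_of_le hv (by omega)) fun c' r' m' p' cp' Z' hc' hx'' => ?_
    obtain ⟨rfl, rfl, rfl, rfl⟩ := h.crosses_unique hc₀ hc' hx hx''
    exact hshort

/-- Conflicting outputs of which the first one is not checkpointed beyond the fork. -/
theorem thirdSlashable_of_conflict_aux {c₁ c₂ : Client V X} {r₁ r₂ : ℕ} (h₁ : E.Live c₁ r₁)
    (h₂ : E.Live c₂ r₂) {Y : Chain V D} {b₁ b₂ : Body V D} (hbb : b₁ ≠ b₂)
    (hb₁ : b₁ :: Y <:+ E.out c₁ r₁) (hb₂ : b₂ :: Y <:+ E.out c₂ r₂)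
    (hL₁ : (E.scan P c₁ r₁).chain <:+ Y) : E.ThirdSlashable P := by
  have hf₁ := h.finalized_of_suffix_out hb₁ (by simp)
  have hf₂ := h.finalized_of_suffix_out hb₂ (by simp)
  by_cases hex : ∃ c r m p cp Z, E.Live c r ∧
      P.Crosses (E.view c r) (E.btc P c r).items Y m p cp Z
  · obtain ⟨c₀, r₀, m, p, cp, Z, hc₀, hx⟩ := hex
    have hZ : Z <:+ (E.scan P c₀ r₀).chain := by
      have := Params.run_chain_suffix (P := P) (W := E.view c₀ r₀) hx.isPrefix
      rwa [hx.next_chain] at this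
    obtain ⟨s₁, hs₁, hc₁, hu₁, hb₁', hL₁'⟩ := h.exists_normal h₁ hb₁ hL₁
    by_cases hYZ : Y <:+ Z
    · obtain ⟨b₀, hb₀⟩ := cons_suffix_of_ne hYZ fun e => hx.above (e ▸ List.suffix_rfl)
      -- At least one of the two children differs from `b₀`, and that output is played against `Z`.
      rcases eq_or_ne b₁ b₀ with rfl | hne
      · have hL₂ : (E.scan P c₂ r₂).chain <:+ Y := by
          refine (suffix_or_cons_suffix (h.scan_chain_suffix_out h₂) hb₂).resolve_right fun hL => ?_
          rcases h.scan_chain_comparable h₂ hc₀ with hc | hc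
          · exact hbb (cons_suffix_inj (hb₀.trans hZ) (hL.trans hc))
          · exact hbb (cons_suffix_inj (hb₀.trans (hZ.trans hc)) hL)
        obtain ⟨s₂, hs₂, hc₂, hu₂, hb₂', hL₂'⟩ := h.exists_normal h₂ hb₂ hL₂
        exact h.thirdSlashable_of_crosses hc₂ hu₂ hbb.symm hb₂' hL₂' hc₀ hx hb₀
      · exact h.thirdSlashable_of_crosses hc₁ hu₁ hne hb₁' hL₁' hc₀ hx hb₀
    · obtain ⟨Y', a, a₀, haa, ha, ha₀⟩ := exists_fork hYZ hx.above
      have hL : (P.run (E.view c₀ r₀) m).chain <:+ Y' :=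
        (suffix_or_cons_suffix hx.below ha).resolve_right fun hL =>
          haa (cons_suffix_inj (hL.trans hx.acceptable.2.2.2.2) ha₀)
      -- `Z` branches off before `Y`; the same item is then also the crossing of the earlier fork
      -- point `Y'`.
      have hx' : P.Crosses (E.view c₀ r₀) (E.btc P c₀ r₀).items Y' m p cp Z :=
        { hx with
          below := hL
          above := fun hZY => cons_not_suffix_self (ha₀.trans hZY) }
      have hL₁'' : (E.scan P c₁ s₁).chain <:+ Y' := by
        refine (suffix_or_cons_suffix hL₁' ha).resolve_right fun hL' => ?_
        rcases h.scan_chain_comparable hc₁ hc₀ with hc | hc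
        · exact haa (cons_suffix_inj (hL'.trans hc) (ha₀.trans hZ))
        · exact hx.above ((hZ.trans hc).trans hL₁')
      exact h.thirdSlashable_of_crosses hc₁ hu₁ haa
        (ha.trans (suffix_of_cons_suffix hb₁')) hL₁'' hc₀ hx' ha₀
  · push Not at hex
    refine h.thirdSlashable_of_fork hbb h₁ h₂ hf₁.2.1 hf₂.2.1 subset_rfl
      (hf₁.2.2.2.mono Set.subset_union_left subset_rfl)
      (hf₂.2.2.2.mono Set.subset_union_right subset_rfl) fun u c r hc hu _ hperm => ?_
    obtain ⟨m, p, cp, Z, hx, -⟩ := exists_crosses_of_permitted hu hperm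
    exact hex c r m p cp Z hc hx

/-- Checkpointed chains never conflict, so at least one of the diverging blocks is beyond the
checkpointed chain of its client. -/
theorem out_comparable_or_thirdSlashable {c₁ c₂ : Client V X} {r₁ r₂ : ℕ} (h₁ : E.Live c₁ r₁)
    (h₂ : E.Live c₂ r₂) : (E.out c₁ r₁ <:+ E.out c₂ r₂ ∨ E.out c₂ r₂ <:+ E.out c₁ r₁) ∨
      E.ThirdSlashable P := by
  by_cases h12 : E.out c₁ r₁ <:+ E.out c₂ r₂
  · exact Or.inl (Or.inl h12)
  by_cases h21 : E.out c₂ r₂ <:+ E.out c₁ r₁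
  · exact Or.inl (Or.inr h21)
  right
  obtain ⟨Y, b₁, b₂, hbb, hb₁, hb₂⟩ := exists_fork h12 h21
  rcases suffix_or_cons_suffix (h.scan_chain_suffix_out h₁) hb₁ with hL₁ | hL₁
  · exact h.thirdSlashable_of_conflict_aux h₁ h₂ hbb hb₁ hb₂ hL₁
  rcases suffix_or_cons_suffix (h.scan_chain_suffix_out h₂) hb₂ with hL₂ | hL₂
  · exact h.thirdSlashable_of_conflict_aux h₂ h₁ hbb.symm hb₂ hb₁ hL₂
  rcases h.scan_chain_comparable h₁ h₂ with hc | hc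
  · exact absurd (cons_suffix_inj (hL₁.trans hc) hL₂) hbb
  · exact absurd (cons_suffix_inj hL₁ (hL₂.trans hc)) hbb

/-- As outputs are comparable, only a shortening has to be excluded. A walk that stops below a block
once output must have met a second finalized child. A stalled client keeps its output or moves to a
checkpointed chain that the previous output does not extend. -/
theorem out_mono_or_thirdSlashable {c : Client V X} {r r' : ℕ} (hr : r ≤ r') (hc : E.Live c r) :
    E.out c r <:+ E.out c r' ∨ E.ThirdSlashable P := by
  have hΔ := P.Δ_pos
  have R := h.babylon.clients
  induction r', hr using Nat.le_induction with
  | base => exact Or.inl List.suffix_rfl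
  | succ s hs ih =>
    rcases ih with ih | ih
    swap
    · exact Or.inr ih
    by_cases hcs : E.Live c (s + 1)
    swap
    · rw [R.offline c _ hcs]; exact Or.inl ih
    rcases h.out_comparable_or_thirdSlashable hc hcs with (hcmp | hcmp) | hcmp
    · exact Or.inl hcmp
    swap
    · exact Or.inr hcmp
    rcases eq_or_ne (E.out c (s + 1)) (E.out c r) with e | hne
    · rw [e]; exact Or.inl List.suffix_rfl
    by_cases hst : (E.scan P c (s + 1)).stalled = none
    · right
      have hwalk := R.normal c _ hcs hst
      have hL := h.scan_chain_suffix_out hcs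
      obtain ⟨b, hb⟩ := cons_suffix_of_ne hcmp hne
      have hbf : P.Finalized (E.view c (s + 1)) (b :: E.out c (s + 1)) :=
        (h.finalized_of_suffix_out hb (by simp)).mono
          (h.babylon.network.view_mono c r (s + 1) (by omega))
      obtain ⟨b', hbf', hbb⟩ : ∃ b', P.Finalized (E.view c (s + 1)) (b' :: E.out c (s + 1)) ∧
          b ≠ b' := by
        by_contra hcon
        push Not at hcon
        exact hwalk.not_existsUnique ⟨b, hbf, fun b' hb' => (hcon b' hb').symm⟩
      obtain ⟨v, hv⟩ := h.exists_honest (s + 1 + T)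
      refine h.thirdSlashable_of_seen_fork hcs hbb hbf hbf' hv
        fun c' r' m p cp Z hc' hx => ?_
      -- The unstalled client has not left its output by a checkpoint, so the validator had not
      -- confirmed the crossing `3Δ` slots before; a truncated difference means slot `0`.
      rcases Nat.eq_zero_or_pos (s + 1 - 3 * P.Δ) with h0 | hpos
      · rw [h0]
        exact h.length_zero_le (c := .inl v) (h.honest_of_le (s := s + 1 + T) hv (by omega)) hc' hx.isPrefix
      · exact h.length_le_of_normal hcs hc' hst hL hx (h.honest_of_le hv (by omega)) (by omega)
    · by_cases hp : (E.scan P c (s + 1)).chain <:+ E.prevOut c (s + 1)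
      · rw [R.frozen c _ hcs hst hp]; exact Or.inl ih
      · have e := R.reset c _ hcs hst hp
        rw [e] at hcmp
        exact absurd (hcmp.trans ih) hp

theorem slashablySafe : E.SlashablySafe P (P.n / 3 : ℝ) := by
  refine ⟨fun hns => ?_, fun v c r hv hc hsl => h.not_violates hv hc hsl.1⟩
  by_contra hT
  exact hns ⟨fun c r c' r' hc hc' =>
      (h.out_comparable_or_thirdSlashable hc hc').resolve_right hT,
    fun c r r' hr hc _ => (h.out_mono_or_thirdSlashable hr hc).resolve_right hT⟩

end Execution.Regular

end Safety

/-! ### Overwhelming probability: monotonicity and conjunction. -/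

section Probability

variable {Ω : ℕ → Type x} [∀ s, MeasurableSpace (Ω s)]
  {μ : ∀ s, MeasureTheory.Measure (Ω s)} [∀ s, MeasureTheory.IsProbabilityMeasure (μ s)]
  {p q : ∀ s, Ω s → Prop}

theorem Overwhelming.mono (hp : Overwhelming μ p) (hpq : ∀ s ω, p s ω → q s ω) :
    Overwhelming μ q := by
  refine hp.trans_abs_le fun s => ?_
  rw [abs_of_nonneg ENNReal.toReal_nonneg, abs_of_nonneg ENNReal.toReal_nonneg]
  exact ENNReal.toReal_mono (MeasureTheory.measure_ne_top _ _)
    (MeasureTheory.measure_mono fun ω hω hpω => hω (hpq s ω hpω))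

/-- A union bound; measures are monotone and subadditive on arbitrary sets, so the events need not
be measurable. -/
theorem Overwhelming.and (hp : Overwhelming μ p) (hq : Overwhelming μ q) :
    Overwhelming μ fun s ω => p s ω ∧ q s ω := by
  refine (hp.add hq).trans_abs_le fun s => ?_
  have hle : μ s {ω | ¬ (p s ω ∧ q s ω)} ≤ μ s {ω | ¬ p s ω} + μ s {ω | ¬ q s ω} :=
    (MeasureTheory.measure_mono fun ω hω => not_and_or.1 hω).trans
      (MeasureTheory.measure_union_le _ _)
  rw [abs_of_nonneg ENNReal.toReal_nonneg, Pi.add_apply,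
    abs_of_nonneg (add_nonneg ENNReal.toReal_nonneg ENNReal.toReal_nonneg),
    ← ENNReal.toReal_add (MeasureTheory.measure_ne_top _ _) (MeasureTheory.measure_ne_top _ _)]
  exact ENNReal.toReal_mono (ENNReal.add_ne_top.2
    ⟨MeasureTheory.measure_ne_top _ _, MeasureTheory.measure_ne_top _ _⟩) hle

end Probability

end Babylon

theorem theorem2 {V : Type*} {X : Type*} {D : Type*} [DecidableEq V]
    (P : ℕ → Babylon.Params V D) (T : ℕ → ℕ) (hT : ∀ s, 2 * (P s).Δ ≤ T s)
    {Ω : ℕ → Type*} [∀ s, MeasurableSpace (Ω s)]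
    (μ : ∀ s, MeasureTheory.Measure (Ω s)) [∀ s, MeasureTheory.IsProbabilityMeasure (μ s)]
    (E : ∀ s, Ω s → Babylon.Execution V X D)
    (hE : ∀ s ω, (E s ω).IsBabylon (P s))
    (hactive : ∀ s ω, (E s ω).HonestActive (P s))
    (hhash : Babylon.Overwhelming μ fun s ω => (E s ω).NoCollision (P s))
    (hsig : Babylon.Overwhelming μ fun s ω => (E s ω).NoForgery)
    (hbtc : Babylon.Overwhelming μ fun s ω => (E s ω).BitcoinSecure (P s) (T s)) :
    Babylon.Overwhelming μ fun s ω => (E s ω).SlashablySafe (P s) ((P s).n / 3 : ℝ) := by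
  refine Babylon.Overwhelming.mono ((hhash.and hsig).and hbtc) fun s ω hω => ?_
  exact Babylon.Execution.Regular.slashablySafe
    ⟨hE s ω, hactive s ω, hω.1.1, hω.1.2, hω.2, hT s⟩
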